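/- **Conventions.** The players are $\top$ (machine) and $\bot$ (environment), and $\neg\wp$ is the adversary of $\wp$. A move is a finite string over the keyboard alphabet; a labeled move is a move prefixed with a player; a run is a finite or infinite sequence of labeled moves; a position is a finite run. A (constant) game $A$ is given by a set of legal runs, such that a run is legal iff all its nonempty finite initial segments are, and by a winner for every run. A run is $\wp$-illegal if the last move of its shortest illegal initial segment is made by $\wp$; such a run is won by $\neg\wp$. A run $\Delta$ is a $\wp$-delay of $\Gamma$ if each player makes the same sequence of moves in both and, whenever the $n$th move of $\wp$ is later than the $k$th move of $\neg\wp$ in $\Gamma$, it is so in $\Delta$. $A$ is static if, whenever $\wp$ wins $\Gamma$ and $\Delta$ is a $\wp$-delay of $\Gamma$, $\wp$ wins $\Delta$. In $\neg A$ the players are interchanged. In $A\vee B$ legal runs consist of moves $1.\alpha$ and $2.\alpha$ whose two subruns (prefixes deleted) are legal in $A$ and $B$; a legal run is won by $\top$ iff $\top$ wins at least one subrun. $A\to B$ is $\neg A\vee B$. For a run $\Gamma$ and an infinite bitstring $v$, $\Gamma^{\preceq v}$ is obtained by keeping only the moves $u.\alpha$ with $u$ an initial segment of $v$ and deleting the prefix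 "$u.$" from them. **Tight recurrence** $R^{T}A$. A bitstring is an actual node of a position $\Phi$ if it is empty or is $u0$ or $u1$ with $\Phi$ containing the move "$u{:}$"; an actual node is outer if it is not a proper prefix of another one. In a legal position $\Phi$ the legal moves are: by $\bot$, a switch move $w$, with $w$ an actual node; by $\bot$, a replicative move "$w{:}$", with $w$ an outer actual node; by either player $\wp$, a move $w.\alpha$, where $w$ is an actual node and, for every infinite bitstring $v$, $\alpha$ is a legal move by $\wp$ in the position $\Phi^{\preceq wv}$ of $A$. **Loose recurrence** $R^{L}A$. A run $\Gamma$ is legal iff each labeled move is either a switch move $w$ by $\bot$ ($w$ any finite bitstring) or $w.\alpha$ by either player ($w$ any finite bitstring), and $\Gamma^{\preceq v}$ is a legal run of $A$ for every infinite bitstring $v$. **Winner.** In both recurrences a legal run $\Gamma$ is won by $\bot$ iff it has only finitely many switch moves and $\Gamma^{\preceq t}$ is a $\bot$-won run of $A$, where $t$ is the last switch move followed by infinitely many $0$s ($t=000\ldots$ if there is no switch move). **Machines.** An easy-play machine (EPM) is a deterministic interactive algorithm: a machine with effective transitions between configurations which at each step either computes, or makes a move, or grants permission, in which case the environment may make one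 move or none. It wins $A$ if every run that it can generate, whatever the environment does, is won by $\top$, and permission is granted infinitely often unless the run is $\bot$-illegal. A formula $F(P)$ is uniformly valid if there is a single EPM that wins $F(A)$ for every static game $A$. **Theorem.** The tight and the loose toggling-branching recurrences are logically equivalent: the formulas $R^{T}P\to R^{L}P$ and $R^{L}P\to R^{T}P$ are both uniformly valid. -/

import Mathlib

namespace CoL

/-! ### Players, moves, runs -/

/-- The two players: the machine `top` and its environment `bot`. -/
inductive Player
  | top
  | bot
  deriving DecidableEq

/-- The adversary of a player. -/
def Player.adv : Player → Player
  | .top => .bot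
  | .bot => .top

theorem Player.adv_adv (p : Player) : p.adv.adv = p := by cases p <;> rfl

/-- The keyboard alphabet: the bits `0` and `1` (`bit false` and `bit true`), the symbol `2`, the dot,
the colon, and the remaining ninety printable characters. -/
inductive Key
  | bit (b : Bool)
  | two
  | dot
  | colon
  | other (i : Fin 90)
  deriving DecidableEq

/-- The obvious coding of the alphabet. -/
def Key.equivSum : Key ≃ Bool ⊕ Fin 3 ⊕ Fin 90 where
  toFun
    | .bit b => .inl b
    | .two => .inr (.inl 0)
    | .dot => .inr (.inl 1)
    | .colon => .inr (.inl 2)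
    | .other i => .inr (.inr i)
  invFun
    | .inl b => .bit b
    | .inr (.inl 0) => .two
    | .inr (.inl 1) => .dot
    | .inr (.inl 2) => .colon
    | .inr (.inr i) => .other i
  left_inv x := by cases x <;> rfl
  right_inv x := by
    rcases x with b | i | i
    · rfl
    · fin_cases i <;> rfl
    · rfl

instance Key.primcodable : Primcodable Key := Primcodable.ofEquiv _ Key.equivSum

/-- A move is a finite string over the keyboard alphabet. -/
abbrev Move := List Key

/-- A labeled move: a move together with the player who makes it. -/
abbrev Labmove := Player × Move

/-- A position: a finite run. -/
abbrev Position := List Labmove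

/-- A run: a finite or infinite sequence of labeled moves. -/
abbrev Run := Stream'.Seq Labmove

/-- Interchanging the two players in a labeled move. -/
def Labmove.flip (l : Labmove) : Labmove := (l.1.adv, l.2)

theorem take_prefix {α : Type*} (s : Stream'.Seq α) {m n : ℕ} (h : m ≤ n) :
    s.take m <+: s.take n := by
  rw [List.prefix_iff_getElem?]
  intro i hi
  have hlt : i < m := lt_of_lt_of_le hi Stream'.Seq.length_take_le
  rw [← List.getElem?_eq_getElem hi, Stream'.Seq.getElem?_take, Stream'.Seq.getElem?_take,
    if_pos hlt, if_pos (lt_of_lt_of_le hlt h)]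

theorem take_map {α β : Type*} (f : α → β) (s : Stream'.Seq α) (n : ℕ) :
    (s.map f).take n = (s.take n).map f := by
  apply List.ext_getElem?
  intro i
  rw [Stream'.Seq.getElem?_take, List.getElem?_map, Stream'.Seq.getElem?_take]
  split_ifs <;> simp

open Classical in
/-- Apply the partial function `g` to every member of a finite or infinite sequence, deleting the
members at which it is undefined. The `k`th entry of the result is read off from the first initial
segment of `s` that determines it. -/
noncomputable def filterMapSeq {α β : Type*} (g : α → Option β) (s : Stream'.Seq α) :
    Stream'.Seq β :=
  ⟨fun k => if h : ∃ n, k < ((s.take n).filterMap g).length then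
      ((s.take (Nat.find h)).filterMap g)[k]? else none, by
    intro k hk
    beta_reduce at hk ⊢
    by_cases h : ∃ n, k < ((s.take n).filterMap g).length
    · rw [dif_pos h] at hk
      have := Nat.find_spec h
      rw [List.getElem?_eq_none_iff] at hk
      omega
    · rw [dif_neg]
      rintro ⟨n, hn⟩
      exact h ⟨n, by omega⟩⟩

/-- The entries of `filterMapSeq g s` are those of the lists obtained from the initial segments. -/
theorem filterMapSeq_get?_eq_some {α β : Type*} (g : α → Option β) (s : Stream'.Seq α) (k : ℕ)
    (b : β) : (filterMapSeq g s).get? k = some b ↔ ∃ n, ((s.take n).filterMap g)[k]? = some b := by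
  classical
  have key : ∀ m n, m ≤ n → ∀ c, ((s.take m).filterMap g)[k]? = some c →
      ((s.take n).filterMap g)[k]? = some c := by
    intro m n hmn c hc
    obtain ⟨t, ht⟩ := (take_prefix s hmn).filterMap g
    rw [← ht]
    have hk : k < ((s.take m).filterMap g).length := by
      by_contra hcon
      rw [List.getElem?_eq_none (by omega)] at hc
      cases hc
    rw [List.getElem?_append_left hk]
    exact hc
  change (if h : ∃ n, k < ((s.take n).filterMap g).length then
    ((s.take (Nat.find h)).filterMap g)[k]? else none) = some b ↔ _
  constructor
  · intro h
    split_ifs at h with hx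
    exact ⟨_, h⟩
  · rintro ⟨n, hn⟩
    have hx : ∃ n, k < ((s.take n).filterMap g).length := by
      refine ⟨n, ?_⟩
      by_contra hcon
      rw [List.getElem?_eq_none (by omega)] at hn
      cases hn
    rw [dif_pos hx]
    have hs := Nat.find_spec hx
    have h2 := List.getElem?_eq_getElem hs
    rcases le_total n (Nat.find hx) with hle | hle
    · exact key _ _ hle _ hn
    · have h3 := key _ _ hle _ h2
      rw [hn] at h3
      rw [h2, h3]

/-! ### Constant games -/

/-- For a set `L` of legal positions: the run `Γ` is illegal because of player `p`, that is, the last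
move of the shortest illegal initial segment of `Γ` is made by `p`. -/
def IllegalBy (L : Set Position) (p : Player) (Γ : Run) : Prop :=
  ∃ n α, Γ.take n ∈ L ∧ Γ.get? n = some (p, α) ∧ Γ.take (n + 1) ∉ L

/-- A constant game. It is given by its legal positions (a run is legal iff all its finite initial
segments are) and by the winner of every run; a player who makes the first illegal move loses. -/
structure Game where
  legalPos : Set Position
  nil_mem : [] ∈ legalPos
  mem_of_prefix : ∀ Φ Ψ : Position, Φ <+: Ψ → Ψ ∈ legalPos → Φ ∈ legalPos
  winner : Run → Player
  winner_of_illegal : ∀ p Γ, IllegalBy legalPos p Γ → winner Γ = p.adv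

/-- `Γ` is a legal run of `A`. -/
def Game.Legal (A : Game) (Γ : Run) : Prop := ∀ n, Γ.take n ∈ A.legalPos

theorem IllegalBy.unique {L : Set Position} (hL : ∀ Φ Ψ : Position, Φ <+: Ψ → Ψ ∈ L → Φ ∈ L)
    {p q : Player} {Γ : Run} (hp : IllegalBy L p Γ) (hq : IllegalBy L q Γ) : p = q := by
  obtain ⟨m, α, h1, h2, h3⟩ := hp
  obtain ⟨n, β, k1, k2, k3⟩ := hq
  rcases lt_trichotomy m n with h | h | h
  · exact absurd (hL _ _ (take_prefix Γ h) k1) h3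
  · subst h
    rw [h2] at k2
    exact (Prod.mk.inj (Option.some.inj k2)).1
  · exact absurd (hL _ _ (take_prefix Γ h) h1) k3

open Classical in
/-- The game with legal positions `L` in which a legal run is won by `outcome`, and in which a player
who makes the first illegal move loses. -/
noncomputable def Game.ofOutcome (L : Set Position) (h0 : [] ∈ L)
    (hL : ∀ Φ Ψ : Position, Φ <+: Ψ → Ψ ∈ L → Φ ∈ L) (outcome : Run → Player) : Game where
  legalPos := L
  nil_mem := h0
  mem_of_prefix := hL
  winner Γ := if IllegalBy L .top Γ then .bot else if IllegalBy L .bot Γ then .top else outcome Γ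
  winner_of_illegal p Γ h := by
    cases p
    · rw [if_pos h]; rfl
    · rw [if_neg, if_pos h]
      · rfl
      · intro h'
        cases h'.unique hL h

/-! ### Static games -/

/-- The sequence of the moves that player `p` makes in `Γ`. -/
noncomputable def movesOf (p : Player) (Γ : Run) : Stream'.Seq Move :=
  filterMapSeq (fun l : Labmove => if l.1 = p then some l.2 else none) Γ

/-- Entry number `i` of `Γ` is the `n`th labeled move of player `p` in `Γ` (counting from `0`). -/
def IsNthMove (p : Player) (n i : ℕ) (Γ : Run) : Prop :=
  (∃ α, Γ.get? i = some (p, α)) ∧ (Γ.take i).countP (fun l => decide (l.1 = p)) = n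

/-- `Δ` is a `p`-delay of `Γ`: both players make the same sequences of moves in both runs, and if the
`n`th move of `p` is made later than the `k`th move of its adversary in `Γ`, then so it is in `Δ`. -/
def IsDelay (p : Player) (Δ Γ : Run) : Prop :=
  (∀ q, movesOf q Δ = movesOf q Γ) ∧
  ∀ n k i j i' j', IsNthMove p n i Γ → IsNthMove p.adv k j Γ → j < i →
    IsNthMove p n i' Δ → IsNthMove p.adv k j' Δ → j' < i'

/-- A game is static iff delaying a player's moves in a run won by that player leaves the run won. -/
def Game.Static (A : Game) : Prop :=
  ∀ p Γ Δ, A.winner Γ = p → IsDelay p Δ Γ → A.winner Δ = p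

/-! ### Negation, parallel disjunction, implication -/

/-- The negation of a game: the two players interchange their roles. -/
def Game.neg (A : Game) : Game where
  legalPos := {Φ | Φ.map Labmove.flip ∈ A.legalPos}
  nil_mem := A.nil_mem
  mem_of_prefix Φ Ψ h hΨ := A.mem_of_prefix _ _ (h.map _) hΨ
  winner Γ := (A.winner (Γ.map Labmove.flip)).adv
  winner_of_illegal p Γ h := by
    obtain ⟨n, α, h1, h2, h3⟩ := h
    have key : IllegalBy A.legalPos p.adv (Γ.map Labmove.flip) := by
      refine ⟨n, α, ?_, ?_, ?_⟩
      · rw [take_map]; exact h1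
      · rw [Stream'.Seq.map_get?, h2]; rfl
      · rw [take_map]; exact h3
    rw [A.winner_of_illegal _ _ key, Player.adv_adv]

/-- If the move is `c.α` for the given symbol `c`, the labeled move with this prefix deleted. -/
def component (c : Key) (l : Labmove) : Option Labmove :=
  match l.2 with
  | d :: .dot :: α => if d = c then some (l.1, α) else none
  | _ => none

/-- The parallel disjunction: the two games are played simultaneously, the moves of the first one
being prefixed with `1.` and those of the second one with `2.`; the machine has to win at least one. -/
noncomputable def Game.por (A B : Game) : Game :=
  Game.ofOutcome
    {Φ | (∀ l ∈ Φ, ∃ α : Move, l.2 = .bit true :: .dot :: α ∨ l.2 = .two :: .dot :: α) ∧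
      Φ.filterMap (component (.bit true)) ∈ A.legalPos ∧
      Φ.filterMap (component .two) ∈ B.legalPos}
    ⟨by simp, A.nil_mem, B.nil_mem⟩
    (fun _ _ h hΨ => ⟨fun l hl => hΨ.1 l (h.subset hl), A.mem_of_prefix _ _ (h.filterMap _) hΨ.2.1,
      B.mem_of_prefix _ _ (h.filterMap _) hΨ.2.2⟩)
    (open Classical in fun Γ =>
      if A.winner (filterMapSeq (component (.bit true)) Γ) = .top ∨
        B.winner (filterMapSeq (component .two) Γ) = .top then .top else .bot)

/-- The implication `A → B`, that is, `¬A ∨ B`. -/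
noncomputable def Game.imp (A B : Game) : Game := A.neg.por B

/-! ### Toggling-branching recurrences -/

/-- A finite bitstring as a move: the switch move to `w`. -/
def switch (w : List Bool) : Move := w.map Key.bit

/-- The replicative move `w:`. -/
def replicate (w : List Bool) : Move := switch w ++ [.colon]

/-- The non-replicative move `w.α`. -/
def inNode (w : List Bool) (α : Move) : Move := switch w ++ .dot :: α

/-- If `m` is `u.α` for an initial segment `u` of the infinite bitstring `v`, then `α`. -/
def strip : Stream' Bool → Move → Option Move
  | _, .dot :: α => some α
  | v, .bit b :: m => if v.head = b then strip v.tail m else none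
  | _, _ => none

theorem strip_eq_some (v : Stream' Bool) (m α : Move) :
    strip v m = some α ↔ ∃ u v', v = u ++ₛ v' ∧ m = inNode u α := by
  induction m generalizing v with
  | nil => simp [strip, inNode]
  | cons k m ih =>
    cases k with
    | dot =>
      simp only [strip, Option.some.injEq]
      constructor
      · rintro rfl
        exact ⟨[], v, rfl, rfl⟩
      · rintro ⟨u, v', -, h⟩
        cases u with
        | nil => simpa [inNode, switch] using h
        | cons b u => simp [inNode, switch] at h
    | bit b =>
      simp only [strip]
      constructor
      · intro h
        split_ifs at h with hb
        obtain ⟨u, v', h1, h2⟩ := (ih v.tail).1 h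
        refine ⟨b :: u, v', ?_, by simp [h2, inNode, switch]⟩
        rw [← Stream'.cons_head_tail v, hb, h1]
        rfl
      · rintro ⟨u, v', h1, h2⟩
        cases u with
        | nil => simp [inNode, switch] at h2
        | cons c u =>
          have h3 : b = c ∧ m = inNode u α := by simpa [inNode, switch] using h2
          obtain ⟨rfl, h3⟩ := h3
          subst h1
          refine (if_pos rfl).trans ?_
          exact (ih _).2 ⟨u, v', rfl, h3⟩
    | two | colon | other =>
      simp only [strip, reduceCtorEq, false_iff]
      rintro ⟨u, v', -, h⟩
      cases u <;> simp [inNode, switch] at h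

/-- `strip` on labeled moves. -/
def stripLab (v : Stream' Bool) (l : Labmove) : Option Labmove :=
  (strip v l.2).map (Prod.mk l.1)

/-- For a position `Φ`: delete all moves except those of the form `u.α` with `u` an initial segment
of `v`, and delete the prefix `u.` from the remaining ones. -/
def Position.thread (Φ : Position) (v : Stream' Bool) : Position := Φ.filterMap (stripLab v)

/-- The same for an arbitrary run. -/
noncomputable def Run.thread (Γ : Run) (v : Stream' Bool) : Run := filterMapSeq (stripLab v) Γ

/-- The infinite bitstring `w000…`. -/
def zeroExt (w : List Bool) : Stream' Bool := w ++ₛ Stream'.const false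

/-- Entry number `i` of `Γ` is the switch move `w` (switch moves are made by `bot`). -/
def IsSwitchAt (Γ : Run) (i : ℕ) (w : List Bool) : Prop := Γ.get? i = some (.bot, switch w)

/-- `w` is the last switch move of `Γ`, or `Γ` has no switch moves and `w` is empty. -/
def IsFinalSwitch (Γ : Run) (w : List Bool) : Prop :=
  (∃ i, IsSwitchAt Γ i w ∧ ∀ j u, IsSwitchAt Γ j u → j ≤ i) ∨
  ((∀ i u, ¬ IsSwitchAt Γ i u) ∧ w = [])

open Classical in
/-- The winner of a legal run of either toggling-branching recurrence of `A`: `bot` wins iff there are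
only finitely many switch moves, and the thread of `A` finally switched to is won by `bot`. -/
noncomputable def recOutcome (A : Game) (Γ : Run) : Player :=
  if {i | ∃ w, IsSwitchAt Γ i w}.Finite ∧
    ∃ w, IsFinalSwitch Γ w ∧ A.winner (Run.thread Γ (zeroExt w)) = .bot then .bot else .top

/-- `v` is an actual node of `Φ`: it is empty, or it is `u0` or `u1` where `Φ` contains `u:`. -/
def IsActual (Φ : Position) (v : List Bool) : Prop :=
  v = [] ∨ ∃ u b p, v = u ++ [b] ∧ (p, replicate u) ∈ Φ

/-- `v` is an outer actual node of `Φ`: not a proper prefix of any other actual node. -/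
def IsOuter (Φ : Position) (v : List Bool) : Prop :=
  IsActual Φ v ∧ ∀ u, IsActual Φ u → v <+: u → u = v

/-- The legal positions of the tight toggling-branching recurrence of `A`. -/
inductive TightLegal (A : Game) : Position → Prop
  | nil : TightLegal A []
  | switch (Φ : Position) (w : List Bool) : TightLegal A Φ → IsActual Φ w →
      TightLegal A (Φ ++ [(.bot, switch w)])
  | replicate (Φ : Position) (w : List Bool) : TightLegal A Φ → IsOuter Φ w →
      TightLegal A (Φ ++ [(.bot, replicate w)])
  | inNode (Φ : Position) (p : Player) (w : List Bool) (α : Move) : TightLegal A Φ →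
      IsActual Φ w →
      (∀ v : Stream' Bool, Position.thread Φ (w ++ₛ v) ++ [(p, α)] ∈ A.legalPos) →
      TightLegal A (Φ ++ [(p, inNode w α)])

theorem TightLegal.of_prefix {A : Game} (Φ Ψ : Position) (h : Φ <+: Ψ) (hΨ : TightLegal A Ψ) :
    TightLegal A Φ := by
  induction hΨ with
  | nil => rw [List.prefix_nil.1 h]; exact .nil
  | switch Ψ w h1 h2 ih =>
    rcases List.prefix_concat_iff.1 h with h | h
    · rw [h]; exact .switch Ψ w h1 h2
    · exact ih h
  | replicate Ψ w h1 h2 ih =>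
    rcases List.prefix_concat_iff.1 h with h | h
    · rw [h]; exact .replicate Ψ w h1 h2
    · exact ih h
  | inNode Ψ p w α h1 h2 h3 ih =>
    rcases List.prefix_concat_iff.1 h with h | h
    · rw [h]; exact .inNode Ψ p w α h1 h2 h3
    · exact ih h

/-- The tight (original) toggling-branching recurrence. -/
noncomputable def Game.tightRec (A : Game) : Game :=
  Game.ofOutcome {Φ | TightLegal A Φ} .nil TightLegal.of_prefix (recOutcome A)

/-- The loose (simplified) toggling-branching recurrence. -/
noncomputable def Game.looseRec (A : Game) : Game :=
  Game.ofOutcome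
    {Φ | (∀ l ∈ Φ, (∃ w, l = (.bot, switch w)) ∨ ∃ p w α, l = (p, inNode w α)) ∧
      ∀ v : Stream' Bool, Position.thread Φ v ∈ A.legalPos}
    ⟨by simp, fun _ => A.nil_mem⟩
    (fun _ _ h hΨ => ⟨fun l hl => hΨ.1 l (h.subset hl),
      fun v => A.mem_of_prefix _ _ (h.filterMap _) (hΨ.2 v)⟩)
    (recOutcome A)

/-! ### Easy-play machines and uniform validity -/

/-- An easy-play machine (EPM): a deterministic interactive machine with effective transitions.
A configuration comprises everything the machine has to hand (state, work tapes, run tape). In a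
permission configuration the machine grants permission, and its environment may respond with one move
or with none; in any other configuration the machine may make one move of its own. The next
configuration depends on the current one and, after a permission, on the environment's response. -/
structure EPM where
  Conf : Type
  [coding : Primcodable Conf]
  start : Conf
  permission : Conf → Bool
  output : Conf → Option Move
  next : Conf → Option Move → Conf
  computable_permission : Computable permission
  computable_output : Computable output
  computable_next : Computable₂ next

/-- The configuration after `t` steps of the computation branch in which the environment responds
with `e t` if permission is granted at step `t`. -/
def EPM.conf (E : EPM) (e : ℕ → Option Move) : ℕ → E.Conf
  | 0 => E.start
  | t + 1 => E.next (E.conf e t) (if E.permission (E.conf e t) then e t else none)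

/-- The labeled move made at step `t` of this computation branch, if any. -/
def EPM.labmoveAt (E : EPM) (e : ℕ → Option Move) (t : ℕ) : Option Labmove :=
  if E.permission (E.conf e t) then (e t).map (Prod.mk .bot)
  else (E.output (E.conf e t)).map (Prod.mk .top)

/-- The run generated by this computation branch. -/
noncomputable def EPM.run (E : EPM) (e : ℕ → Option Move) : Run :=
  filterMapSeq id (Stream'.Seq.ofStream (E.labmoveAt e))

/-- A computation branch is fair iff permission is granted infinitely many times in it. -/
def EPM.Fair (E : EPM) (e : ℕ → Option Move) : Prop :=
  ∀ n, ∃ t, n ≤ t ∧ E.permission (E.conf e t) = true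

/-- `E` wins `A`: every computation branch generates a run won by the machine, and the branch is fair
unless the environment has made the first illegal move. -/
def EPM.Wins (E : EPM) (A : Game) : Prop :=
  ∀ e, A.winner (E.run e) = .top ∧ (E.Fair e ∨ IllegalBy A.legalPos .bot (E.run e))

/-- A formula `F(P)`, given as an operation on games, is uniformly valid iff one and the same machine
wins `F(A)` for every static game `A`. -/
def UniformlyValid (F : Game → Game) : Prop :=
  ∃ E : EPM, ∀ A : Game, A.Static → E.Wins (F A)

end CoL

namespace CoL

/-! ### Limits of chains of positions -/

/-! Both implications are won by machines that answer each environment move with finitely many moves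
and maintain an invariant between the position X of the antecedent and the position Y of the
consequent. The winner of a legal run of either recurrence depends only on whether the switch moves
stop and on the thread finally switched to. So it is enough that at every stage X and Y contain
equally many switch moves and have the same thread along the last switch move extended by zeros
(`recOutcome_eq_bot_of`). `reactiveEPM_wins` and `imp_wins` reduce the rest to preservation of the
invariant. Tight to loose: the machine copies. Before a move at w is copied into the tight tree, the
proper initial segments of w not yet replicated get replicated, which affects neither threads nor
switch moves (`TightLegal.append_newNodes`). All threads agree at every stage. Loose to tight: the
machine keeps a finite list matching each outer actual tight node with a loose node. Distinct listed
nodes are incomparable in either tree, and matched nodes have the same thread for all infinite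
continuations. A tight replication extends a pair by either bit, without any move in the loose tree.
A move at a node of one tree is repeated at the partners of its listed extensions. The danger is a
loose move strictly below a listed loose node, which would separate its continuations. Hence, before
each reaction, every listed loose node is padded with at least as many zeros as the address of the
move has bits. Zeros are chosen since they do not change the infinite string w000…. The padded nodes
need not cover the loose tree, but only tight threads have to be matched. -/

/-- The sequence `s` is the limit of the finite sequences `Ψ t`. -/
def IsLimit {α : Type*} (Ψ : ℕ → List α) (s : Stream'.Seq α) : Prop :=
  ∀ k a, s.get? k = some a ↔ ∃ t, (Ψ t)[k]? = some a

/-- An increasing sequence of positions. -/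
def IsChain {α : Type*} (Ψ : ℕ → List α) : Prop := ∀ m n, m ≤ n → Ψ m <+: Ψ n

theorem getElem?_of_prefix {α : Type*} {l₁ l₂ : List α} (h : l₁ <+: l₂) {k : ℕ} {a : α}
    (hk : l₁[k]? = some a) : l₂[k]? = some a := by
  obtain ⟨t, rfl⟩ := h
  rw [List.getElem?_append_left (List.getElem?_eq_some_iff.1 hk).1]
  exact hk

theorem isChain_of_succ {α : Type*} {Ψ : ℕ → List α} (h : ∀ t, Ψ t <+: Ψ (t + 1)) : IsChain Ψ := by
  intro m n hmn
  induction hmn with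
  | refl => exact List.prefix_rfl
  | step _ ih => exact ih.trans (h _)

theorem IsChain.filterMap {α β : Type*} {Ψ : ℕ → List α} (h : IsChain Ψ) (g : α → Option β) :
    IsChain (fun t => (Ψ t).filterMap g) := fun m n hmn => (h m n hmn).filterMap g

theorem IsChain.map {α β : Type*} {Ψ : ℕ → List α} (h : IsChain Ψ) (g : α → β) :
    IsChain (fun t => (Ψ t).map g) := fun m n hmn => (h m n hmn).map g

theorem isLimit_filterMapSeq_take {α β : Type*} (g : α → Option β) (s : Stream'.Seq α) :
    IsLimit (fun n => (s.take n).filterMap g) (filterMapSeq g s) :=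
  fun k b => filterMapSeq_get?_eq_some g s k b

namespace IsLimit

variable {α β : Type*} {Ψ Φ : ℕ → List α} {s s' : Stream'.Seq α}

theorem unique (h : IsLimit Ψ s) (h' : IsLimit Ψ s') : s = s' := by
  apply Stream'.Seq.ext
  intro k
  apply Option.ext
  intro a
  rw [h k a, h' k a]

/-- Two families of positions that dominate each other have the same limit. This allows dropping
early stages and counting moves that are still pending. -/
theorem cofinal (h : IsLimit Ψ s) (h₁ : ∀ t, ∃ u, Ψ t <+: Φ u) (h₂ : ∀ u, ∃ t, Φ u <+: Ψ t) :
    IsLimit Φ s := by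
  intro k a
  rw [h k a]
  constructor
  · rintro ⟨t, ht⟩
    obtain ⟨u, hu⟩ := h₁ t
    exact ⟨u, getElem?_of_prefix hu ht⟩
  · rintro ⟨t, ht⟩
    obtain ⟨u, hu⟩ := h₂ t
    exact ⟨u, getElem?_of_prefix hu ht⟩

theorem take_length (h : IsLimit Ψ s) (t : ℕ) : s.take (Ψ t).length = Ψ t := by
  apply List.ext_getElem?
  intro k
  rw [Stream'.Seq.getElem?_take]
  split_ifs with hk
  · rw [List.getElem?_eq_getElem hk]
    exact (h k _).2 ⟨t, List.getElem?_eq_getElem hk⟩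
  · rw [List.getElem?_eq_none (by omega)]

theorem exists_take_prefix (h : IsLimit Ψ s) (hΨ : IsChain Ψ) (n : ℕ) :
    ∃ t, s.take n <+: Ψ t := by
  -- Finitely many entries appear at finitely many stages, and in a chain the latest of these stages
  -- shows them all.
  have key : ∀ n, ∃ t, ∀ k < n, ∀ a, s.get? k = some a → (Ψ t)[k]? = some a := by
    intro n
    induction n with
    | zero => exact ⟨0, by simp⟩
    | succ n ih =>
      obtain ⟨t, ht⟩ := ih
      cases hn : s.get? n with
      | none =>
        refine ⟨t, fun k hk a ha => ?_⟩
        rcases Nat.lt_succ_iff_lt_or_eq.1 hk with hk | rfl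
        · exact ht k hk a ha
        · rw [hn] at ha; cases ha
      | some b =>
        obtain ⟨u, hu⟩ := (h n b).1 hn
        refine ⟨max t u, fun k hk a ha => ?_⟩
        rcases Nat.lt_succ_iff_lt_or_eq.1 hk with hk | rfl
        · exact getElem?_of_prefix (hΨ _ _ (le_max_left _ _)) (ht k hk a ha)
        · rw [hn] at ha
          cases ha
          exact getElem?_of_prefix (hΨ _ _ (le_max_right _ _)) hu
  obtain ⟨t, ht⟩ := key n
  refine ⟨t, ?_⟩
  rw [List.prefix_iff_getElem?]
  intro i hi
  have hin : i < n := lt_of_lt_of_le hi Stream'.Seq.length_take_le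
  refine ht i hin _ ?_
  have := List.getElem?_eq_getElem hi
  rwa [Stream'.Seq.getElem?_take, if_pos hin] at this

theorem filterMap (h : IsLimit Ψ s) (hΨ : IsChain Ψ) (g : α → Option β) :
    IsLimit (fun t => (Ψ t).filterMap g) (filterMapSeq g s) := by
  refine (isLimit_filterMapSeq_take g s).cofinal (fun n => ?_) (fun t => ?_)
  · obtain ⟨t, ht⟩ := h.exists_take_prefix hΨ n
    exact ⟨t, ht.filterMap g⟩
  · exact ⟨(Ψ t).length, by rw [h.take_length]⟩

theorem map (h : IsLimit Ψ s) (f : α → β) : IsLimit (fun t => (Ψ t).map f) (s.map f) := by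
  intro k b
  simp only [Stream'.Seq.map_get?, List.getElem?_map, Option.map_eq_some_iff]
  constructor
  · rintro ⟨a, ha, rfl⟩
    obtain ⟨t, ht⟩ := (h k a).1 ha
    exact ⟨t, a, ht, rfl⟩
  · rintro ⟨t, a, ht, rfl⟩
    exact ⟨a, (h k a).2 ⟨t, ht⟩, rfl⟩

end IsLimit

theorem IsLimit.legal {A : Game} {Ψ : ℕ → Position} {Γ : Run} (h : IsLimit Ψ Γ) (hΨ : IsChain Ψ)
    (hA : ∀ t, Ψ t ∈ A.legalPos) : A.Legal Γ := by
  intro n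
  obtain ⟨t, ht⟩ := h.exists_take_prefix hΨ n
  exact A.mem_of_prefix _ _ ht (hA t)

theorem not_illegalBy {L : Set Position} {Γ : Run} (h : ∀ n, Γ.take n ∈ L) (p : Player) :
    ¬ IllegalBy L p Γ := fun ⟨n, _, _, _, h3⟩ => h3 (h (n + 1))

theorem ofOutcome_winner {L : Set Position} {h0 : [] ∈ L}
    {hL : ∀ Φ Ψ : Position, Φ <+: Ψ → Ψ ∈ L → Φ ∈ L} {outcome : Run → Player} {Γ : Run}
    (h : ∀ n, Γ.take n ∈ L) : (Game.ofOutcome L h0 hL outcome).winner Γ = outcome Γ := by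
  simp only [Game.ofOutcome]
  rw [if_neg (not_illegalBy h _), if_neg (not_illegalBy h _)]

/-! ### Decomposition of moves -/

/-- The maximal initial block of bits of a move, and the rest of it. -/
def parse : Move → List Bool × Move
  | .bit b :: m => (b :: (parse m).1, (parse m).2)
  | m => ([], m)

/-- What follows the bits (nothing, a colon, or a dot) tells the three kinds of moves apart; the
injectivity and disjointness facts come from comparing parses. -/
theorem parse_switch (w : List Bool) : parse (switch w) = (w, []) := by
  induction w with
  | nil => rfl
  | cons b w ih =>
    change parse (.bit b :: switch w) = _
    rw [parse, ih]

theorem parse_replicate (w : List Bool) : parse (replicate w) = (w, [.colon]) := by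
  induction w with
  | nil => rfl
  | cons b w ih =>
    change parse (.bit b :: replicate w) = _
    rw [parse, ih]

theorem parse_inNode (w : List Bool) (α : Move) : parse (inNode w α) = (w, .dot :: α) := by
  induction w with
  | nil => rfl
  | cons b w ih =>
    change parse (.bit b :: inNode w α) = _
    rw [parse, ih]

theorem replicate_injective : Function.Injective replicate := by
  intro u w h
  have := congrArg parse h
  rw [parse_replicate, parse_replicate] at this
  exact congrArg Prod.fst this

theorem replicate_ne_inNode (u w : List Bool) (α : Move) : replicate u ≠ inNode w α := by
  intro h
  have := congrArg parse h
  simp [parse_replicate, parse_inNode] at this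

theorem replicate_ne_switch (u w : List Bool) : replicate u ≠ switch w := by
  intro h
  have := congrArg parse h
  simp [parse_replicate, parse_switch] at this

theorem switch_ne_inNode (u w : List Bool) (α : Move) : switch u ≠ inNode w α := by
  intro h
  have := congrArg parse h
  simp [parse_switch, parse_inNode] at this

/-! ### Threads -/

/-- The finite bitstring `u` is an initial segment of the infinite bitstring `z`. -/
def OnStream (u : List Bool) (z : Stream' Bool) : Prop := z.take u.length = u

instance (u : List Bool) (z : Stream' Bool) : Decidable (OnStream u z) :=
  inferInstanceAs (Decidable (_ = _))

theorem onStream_append (u : List Bool) (z : Stream' Bool) : OnStream u (u ++ₛ z) := by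
  rw [OnStream, Stream'.take_append_of_le_length (h := le_rfl), List.take_length]

theorem OnStream.eq_append {u : List Bool} {z : Stream' Bool} (h : OnStream u z) :
    z = u ++ₛ z.drop u.length := by
  conv_lhs => rw [← Stream'.append_take_drop u.length z]
  rw [h]

theorem OnStream.prefix_or_prefix {u v : List Bool} {z : Stream' Bool} (hu : OnStream u z)
    (hv : OnStream v z) : u <+: v ∨ v <+: u := by
  rw [← hu, ← hv, Stream'.take_prefix, Stream'.take_prefix]
  exact le_total _ _

theorem OnStream.of_prefix {u v : List Bool} {z : Stream' Bool} (h : u <+: v) (hv : OnStream v z) :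
    OnStream u z := by
  obtain ⟨t, rfl⟩ := h
  rw [hv.eq_append, Stream'.append_append_stream]
  exact onStream_append _ _

/-- For a node no longer than v, the continuation z is irrelevant. Padding exists to secure this
length bound. -/
theorem onStream_append_iff {u v : List Bool} (z : Stream' Bool) (h : u.length ≤ v.length) :
    OnStream u (v ++ₛ z) ↔ u <+: v := by
  rw [OnStream, Stream'.take_append_of_le_length (h := h), List.prefix_iff_eq_take, eq_comm]

theorem strip_inNode (z : Stream' Bool) (u : List Bool) (α : Move) :
    strip z (inNode u α) = if OnStream u z then some α else none := by
  split_ifs with h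
  · exact (strip_eq_some _ _ _).2 ⟨u, _, h.eq_append, rfl⟩
  · rw [Option.eq_none_iff_forall_ne_some]
    intro β hβ
    obtain ⟨w, v', rfl, h2⟩ := (strip_eq_some _ _ _).1 hβ
    have := congrArg parse h2
    rw [parse_inNode, parse_inNode] at this
    rw [(Prod.mk.inj this).1] at h
    exact h (onStream_append _ _)

theorem strip_switch (z : Stream' Bool) (u : List Bool) : strip z (switch u) = none := by
  rw [Option.eq_none_iff_forall_ne_some]
  intro β hβ
  obtain ⟨w, v', -, h2⟩ := (strip_eq_some _ _ _).1 hβ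
  exact switch_ne_inNode _ _ _ h2

theorem strip_replicate (z : Stream' Bool) (u : List Bool) : strip z (replicate u) = none := by
  rw [Option.eq_none_iff_forall_ne_some]
  intro β hβ
  obtain ⟨w, v', -, h2⟩ := (strip_eq_some _ _ _).1 hβ
  exact replicate_ne_inNode _ _ _ h2

theorem thread_append (Φ Ψ : Position) (z : Stream' Bool) :
    Position.thread (Φ ++ Ψ) z = Position.thread Φ z ++ Position.thread Ψ z :=
  List.filterMap_append

theorem thread_inNode (p : Player) (u : List Bool) (α : Move) (z : Stream' Bool) :
    Position.thread [(p, inNode u α)] z = if OnStream u z then [(p, α)] else [] := by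
  unfold Position.thread
  rw [List.filterMap_cons, stripLab, strip_inNode]
  split_ifs <;> simp

theorem thread_switch (p : Player) (u : List Bool) (z : Stream' Bool) :
    Position.thread [(p, switch u)] z = [] := by
  simp [Position.thread, stripLab, strip_switch]

theorem thread_replicate (p : Player) (u : List Bool) (z : Stream' Bool) :
    Position.thread [(p, replicate u)] z = [] := by
  simp [Position.thread, stripLab, strip_replicate]

/-! ### Switch moves and the outcome of a recurrence -/

/-- The address of a switch move. -/
def switchOf (l : Labmove) : Option (List Bool) :=
  -- Re-encoding the parsed bits tests at once the label and that nothing follows the bits.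
  if l = (.bot, switch (parse l.2).1) then some (parse l.2).1 else none

theorem switchOf_eq_some {l : Labmove} {w : List Bool} :
    switchOf l = some w ↔ l = (.bot, switch w) := by
  unfold switchOf
  constructor
  · intro h
    split_ifs at h with h'
    rw [Option.some.inj h] at h'
    exact h'
  · rintro rfl
    simp [parse_switch]

/-- The switch moves of a position. -/
def switches (Φ : Position) : List (List Bool) := Φ.filterMap switchOf

/-- The last switch move of a position, or the empty bitstring. -/
def lastSwitch (Φ : Position) : List Bool := (switches Φ).getLast?.getD []

theorem switches_append (Φ Ψ : Position) : switches (Φ ++ Ψ) = switches Φ ++ switches Ψ :=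
  List.filterMap_append

theorem switches_switch (w : List Bool) : switches [(.bot, switch w)] = [w] := by
  simp [switches, switchOf_eq_some.2 rfl]

theorem switches_eq_nil {Φ : Position} :
    switches Φ = [] ↔ ∀ w, (Player.bot, switch w) ∉ Φ := by
  simp only [switches, List.filterMap_eq_nil_iff, Option.eq_none_iff_forall_ne_some, ne_eq,
    switchOf_eq_some]
  constructor
  · intro h w hw
    exact h _ hw w rfl
  · rintro h l hl w rfl
    exact h w hl

theorem lastSwitch_append_of_nil {Φ Ψ : Position} (h : switches Ψ = []) :
    lastSwitch (Φ ++ Ψ) = lastSwitch Φ := by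
  rw [lastSwitch, switches_append, h, List.append_nil, lastSwitch]

theorem lastSwitch_concat (Φ : Position) (w : List Bool) :
    lastSwitch (Φ ++ [(.bot, switch w)]) = w := by
  rw [lastSwitch, switches_append, switches_switch]
  simp

theorem lastSwitch_cases (Φ : Position) :
    (switches Φ = [] ∧ lastSwitch Φ = []) ∨
    ∃ a b, Φ = a ++ (.bot, switch (lastSwitch Φ)) :: b ∧ switches b = [] := by
  induction Φ using List.reverseRecOn with
  | nil => exact .inl ⟨rfl, rfl⟩
  | append_singleton Φ l ih =>
    cases hl : switchOf l with
    | some w =>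
      rw [switchOf_eq_some] at hl
      subst hl
      exact .inr ⟨Φ, [], by rw [lastSwitch_concat], rfl⟩
    | none =>
      have hn : switches [l] = [] := by simp [switches, hl]
      rw [lastSwitch_append_of_nil hn, switches_append, hn]
      rcases ih with ⟨h1, h2⟩ | ⟨a, b, h1, h2⟩
      · exact .inl ⟨by simp [h1], h2⟩
      · refine .inr ⟨a, b ++ [l], ?_, by simp [switches_append, h2, hn]⟩
        conv_lhs => rw [h1]
        simp

/-- Turns "finitely many switch moves" into stabilization along the chain, the form in which two
runs can be compared stage by stage. -/
theorem switches_stable_iff {Ψ : ℕ → Position} {Γ : Run} (h : IsLimit Ψ Γ) (hΨ : IsChain Ψ)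
    (T : ℕ) : (∀ t, T ≤ t → switches (Ψ t) = switches (Ψ T)) ↔
      ∀ i w, IsSwitchAt Γ i w → i < (Ψ T).length := by
  constructor
  · intro hT i w hi
    by_contra hlt
    obtain ⟨t, ht⟩ := (h i _).1 hi
    have htT : T ≤ t := by
      by_contra hcon
      have := (List.getElem?_eq_some_iff.1
        (getElem?_of_prefix (hΨ t T (by omega)) ht)).1
      omega
    obtain ⟨R, hR⟩ := hΨ T t htT
    have h1 := hT t htT
    rw [← hR, switches_append] at h1
    have h2 : switches R = [] := by simpa using h1
    rw [← hR, List.getElem?_append_right (by omega)] at ht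
    exact switches_eq_nil.1 h2 w (List.mem_of_getElem? ht)
  · intro hT t ht
    obtain ⟨R, hR⟩ := hΨ T t ht
    rw [← hR, switches_append]
    have h2 : switches R = [] := by
      rw [switches_eq_nil]
      intro w hw
      obtain ⟨k, hk⟩ := List.mem_iff_getElem?.1 hw
      have h3 : (Ψ t)[(Ψ T).length + k]? = some (.bot, switch w) := by
        rw [← hR, List.getElem?_append_right (by omega)]
        simpa using hk
      have := hT _ w ((h _ _).2 ⟨t, h3⟩)
      omega
    rw [h2, List.append_nil]

theorem isFinalSwitch_iff {Ψ : ℕ → Position} {Γ : Run} (h : IsLimit Ψ Γ)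
    {T : ℕ} (hT : ∀ i w, IsSwitchAt Γ i w → i < (Ψ T).length) (w : List Bool) :
    IsFinalSwitch Γ w ↔ w = lastSwitch (Ψ T) := by
  have hmem : ∀ i u, IsSwitchAt Γ i u → (Ψ T)[i]? = some (.bot, switch u) := by
    intro i u hi
    rw [← h.take_length T, Stream'.Seq.getElem?_take, if_pos (hT i u hi)]
    exact hi
  have hinj : ∀ u v, (Player.bot, switch u) = (Player.bot, switch v) → u = v := by
    intro u v huv
    have := congrArg parse (Prod.mk.inj huv).2
    simpa [parse_switch] using this
  rcases lastSwitch_cases (Ψ T) with ⟨h1, h2⟩ | ⟨a, b, h1, h2⟩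
  · have hno : ∀ i u, ¬ IsSwitchAt Γ i u := fun i u hi =>
      switches_eq_nil.1 h1 u (List.mem_of_getElem? (hmem i u hi))
    rw [h2]
    constructor
    · rintro (⟨i, hi, -⟩ | ⟨-, hw⟩)
      · exact absurd hi (hno i w)
      · exact hw
    · exact fun hw => .inr ⟨hno, hw⟩
  · set u := lastSwitch (Ψ T)
    have hu : IsSwitchAt Γ a.length u := (h _ _).2 ⟨T, by rw [h1]; simp⟩
    have hmax : ∀ j v, IsSwitchAt Γ j v → j ≤ a.length := by
      intro j v hj
      by_contra hlt
      have h3 := hmem j v hj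
      rw [h1, List.getElem?_append_right (by omega),
        show j - a.length = (j - a.length - 1) + 1 by omega, List.getElem?_cons_succ] at h3
      exact switches_eq_nil.1 h2 v (List.mem_of_getElem? h3)
    constructor
    · rintro (⟨i, hi, hi'⟩ | ⟨hno, -⟩)
      · have : i = a.length := le_antisymm (hmax i w hi) (hi' _ _ hu)
        subst this
        exact hinj _ _ (Option.some.inj (Eq.trans (Eq.symm hi) hu))
      · exact absurd hu (hno _ _)
    · rintro rfl
      exact .inl ⟨_, hu, hmax⟩

theorem recOutcome_eq_bot_iff (A : Game) {Ψ : ℕ → Position} {Γ : Run} (h : IsLimit Ψ Γ)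
    (hΨ : IsChain Ψ) : recOutcome A Γ = .bot ↔ ∃ T, (∀ t, T ≤ t → switches (Ψ t) = switches (Ψ T)) ∧
      A.winner (Run.thread Γ (zeroExt (lastSwitch (Ψ T)))) = .bot := by
  unfold recOutcome
  constructor
  · intro hb
    split_ifs at hb with hc
    obtain ⟨hfin, w, hw, hwin⟩ := hc
    obtain ⟨N, hN⟩ := hfin.bddAbove
    obtain ⟨T, hT⟩ := h.exists_take_prefix hΨ (N + 1)
    have hlt : ∀ i w, IsSwitchAt Γ i w → i < (Ψ T).length := by
      intro i w hi
      have hiN : i ≤ N := hN ⟨w, hi⟩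
      have : (Γ.take (N + 1))[i]? = some (.bot, switch w) := by
        rw [Stream'.Seq.getElem?_take, if_pos (by omega)]
        exact hi
      exact (List.getElem?_eq_some_iff.1 (getElem?_of_prefix hT this)).1
    refine ⟨T, (switches_stable_iff h hΨ T).2 hlt, ?_⟩
    rw [← (isFinalSwitch_iff h hlt w).1 hw]
    exact hwin
  · rintro ⟨T, hT, hwin⟩
    rw [switches_stable_iff h hΨ] at hT
    rw [if_pos]
    refine ⟨(Set.finite_lt_nat (Ψ T).length).subset ?_, _, (isFinalSwitch_iff h hT _).2 rfl, hwin⟩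
    rintro i ⟨w, hi⟩
    exact hT i w hi

/-- The addresses of the switch moves may differ in the two runs: equal counts make them stop at the
same stage, and from then on the selected threads have the same limit. -/
theorem recOutcome_eq_bot_of (A : Game) {X Y : ℕ → Position} {Γ Δ : Run} (hX : IsLimit X Γ)
    (hY : IsLimit Y Δ) (cX : IsChain X) (cY : IsChain Y)
    (hlen : ∀ t, (switches (X t)).length = (switches (Y t)).length)
    (hth : ∀ t, Position.thread (X t) (zeroExt (lastSwitch (X t))) =
      Position.thread (Y t) (zeroExt (lastSwitch (Y t))))
    (h : recOutcome A Δ = .bot) : recOutcome A Γ = .bot := by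
  obtain ⟨T, hT, hw⟩ := (recOutcome_eq_bot_iff A hY cY).1 h
  have hT' : ∀ t, T ≤ t → switches (X t) = switches (X T) := by
    intro t ht
    obtain ⟨R, hR⟩ := cX T t ht
    have h1 : (switches (X t)).length = (switches (X T)).length := by
      rw [hlen, hlen, hT t ht]
    rw [← hR, switches_append] at h1 ⊢
    have : switches R = [] := by simpa using h1
    rw [this, List.append_nil]
  refine (recOutcome_eq_bot_iff A hX cX).2 ⟨T, hT', ?_⟩
  -- Before stage T the selected address may still change, so the limits are taken over the stages
  -- from T on.
  have cofin : ∀ {Z : ℕ → Position} {Θ : Run} (v : Stream' Bool), IsLimit Z Θ → IsChain Z →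
      IsLimit (fun t => Position.thread (Z (T + t)) v) (Run.thread Θ v) := by
    intro Z Θ v hZ cZ
    refine (hZ.filterMap cZ (stripLab v)).cofinal (fun t => ⟨t, ?_⟩) (fun t => ⟨T + t, ?_⟩)
    · exact (cZ t (T + t) (by omega)).filterMap _
    · exact List.prefix_rfl
  have hl : ∀ t, lastSwitch (X (T + t)) = lastSwitch (X T) := fun t => by
    rw [lastSwitch, hT' _ (by omega), lastSwitch]
  have hl' : ∀ t, lastSwitch (Y (T + t)) = lastSwitch (Y T) := fun t => by
    rw [lastSwitch, hT _ (by omega), lastSwitch]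
  have e1 := cofin (zeroExt (lastSwitch (X T))) hX cX
  have e2 := cofin (zeroExt (lastSwitch (Y T))) hY cY
  have : (fun t => Position.thread (X (T + t)) (zeroExt (lastSwitch (X T)))) =
      fun t => Position.thread (Y (T + t)) (zeroExt (lastSwitch (Y T))) := by
    funext t
    rw [← hl t, hth, hl' t]
  rw [this] at e1
  rw [e1.unique e2]
  exact hw

/-! ### Reactive machines -/

/-- The machine which, having received a move `m` in state `s`, changes its state and makes finitely
many moves, as prescribed by `react s m`, before it grants permission again. -/
def reactiveEPM {S : Type} [Primcodable S] (s₀ : S) (react : S → Move → S × List Move)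
    (h : Primrec₂ react) : EPM where
  Conf := S × List Move
  start := (s₀, [])
  permission c := decide (c.2 = [])
  output c := c.2.head?
  next c r := if c.2 = [] then r.elim c (react c.1) else (c.1, c.2.tail)
  computable_permission :=
    (Primrec.eq.decide.comp Primrec.snd (Primrec.const [])).to_comp
  computable_output := (Primrec.list_head?.comp Primrec.snd).to_comp
  computable_next := by
    refine Primrec.to_comp (α := (S × List Move) × Option Move) ?_
    refine Primrec.ite (Primrec.eq.comp (Primrec.snd.comp Primrec.fst) (Primrec.const [])) ?_ ?_
    · refine (Primrec.option_casesOn Primrec.snd Primrec.fst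
        (h.comp₂ ((Primrec.fst.comp Primrec.fst).comp₂ Primrec₂.left) Primrec₂.right)).of_eq ?_
      rintro ⟨c, _ | r⟩ <;> rfl
    · exact Primrec.pair (Primrec.fst.comp Primrec.fst)
        (Primrec.list_tail.comp (Primrec.snd.comp Primrec.fst))

/-- The position reached after `t` steps of a computation branch. -/
def EPM.history (E : EPM) (e : ℕ → Option Move) (t : ℕ) : Position :=
  (List.range t).filterMap (E.labmoveAt e)

theorem EPM.history_succ (E : EPM) (e : ℕ → Option Move) (t : ℕ) :
    E.history e (t + 1) = E.history e t ++ (E.labmoveAt e t).toList := by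
  rw [EPM.history, List.range_succ, List.filterMap_append, EPM.history]
  cases h : E.labmoveAt e t <;> simp [h]

theorem take_ofStream {α : Type*} (f : ℕ → α) (n : ℕ) :
    (Stream'.Seq.ofStream f).take n = (List.range n).map f := by
  apply List.ext_getElem?
  intro k
  rw [Stream'.Seq.getElem?_take, List.getElem?_map]
  split_ifs with h
  · rw [List.getElem?_range h]; rfl
  · rw [List.getElem?_eq_none (by simpa using h)]; rfl

theorem EPM.isLimit_history (E : EPM) (e : ℕ → Option Move) : IsLimit (E.history e) (E.run e) := by
  have h := isLimit_filterMapSeq_take id (Stream'.Seq.ofStream (E.labmoveAt e))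
  have : (fun n => ((Stream'.Seq.ofStream (E.labmoveAt e)).take n).filterMap id) = E.history e := by
    funext n
    rw [take_ofStream, List.filterMap_map]
    rfl
  rw [this] at h
  exact h

/-- The invariant is imposed on the position with the pending moves counted as already made. The
queue is finite after every reaction, so permission always returns and every branch is fair. -/
theorem reactiveEPM_wins {S : Type} [Primcodable S] {s₀ : S} {react : S → Move → S × List Move}
    (h : Primrec₂ react) {G : Game} (Inv : S → Position → Prop) (hnil : Inv s₀ [])
    (hlegal : ∀ s Φ, Inv s Φ → Φ ∈ G.legalPos)
    (hstep : ∀ s Φ m, Inv s Φ → Φ ++ [(.bot, m)] ∈ G.legalPos →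
      Inv (react s m).1 (Φ ++ (.bot, m) :: (react s m).2.map (Prod.mk .top)))
    (hwin : ∀ Ψ Γ, IsChain Ψ → IsLimit Ψ Γ → (∀ t, ∃ s, Inv s (Ψ t)) → G.winner Γ = .top) :
    (reactiveEPM s₀ react h).Wins G := by
  intro e
  set E := reactiveEPM s₀ react h with hE
  have perm : ∀ t, E.permission (E.conf e t) = true ↔ (E.conf e t).2 = [] := fun t =>
    decide_eq_true_iff (p := (E.conf e t).2 = [])
  -- one computation step, according to the pending moves and the response
  have step_none : ∀ t, (E.conf e t).2 = [] → e t = none →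
      E.conf e (t + 1) = E.conf e t ∧ E.labmoveAt e t = none := by
    intro t ht he
    constructor
    · rw [EPM.conf, if_pos ((perm t).2 ht), he]
      exact if_pos ht
    · rw [EPM.labmoveAt, if_pos ((perm t).2 ht), he]; rfl
  have step_some : ∀ t m, (E.conf e t).2 = [] → e t = some m →
      E.conf e (t + 1) = react (E.conf e t).1 m ∧ E.labmoveAt e t = some (.bot, m) := by
    intro t m ht he
    constructor
    · rw [EPM.conf, if_pos ((perm t).2 ht), he]
      exact if_pos ht
    · rw [EPM.labmoveAt, if_pos ((perm t).2 ht), he]; rfl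
  have step_out : ∀ t m q, (E.conf e t).2 = m :: q →
      E.conf e (t + 1) = ((E.conf e t).1, q) ∧ E.labmoveAt e t = some (.top, m) := by
    intro t m q ht
    have hp : ¬ E.permission (E.conf e t) = true := by rw [perm, ht]; simp
    constructor
    · rw [EPM.conf, if_neg hp]
      refine (if_neg (by rw [ht]; simp)).trans ?_
      rw [ht]; rfl
    · rw [EPM.labmoveAt, if_neg hp]
      change ((E.conf e t).2.head?).map _ = _
      rw [ht]; rfl
  -- the pending moves get made
  have drain : ∀ q t, (E.conf e t).2 = q → ∃ t', t ≤ t' ∧ (E.conf e t').2 = [] ∧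
      E.history e t' = E.history e t ++ q.map (Prod.mk .top) := by
    intro q
    induction q with
    | nil => intro t ht; exact ⟨t, le_rfl, ht, by simp⟩
    | cons m q ih =>
      intro t ht
      obtain ⟨h1, h2⟩ := step_out t m q ht
      obtain ⟨t', h3, h4, h5⟩ := ih (t + 1) (by rw [h1])
      refine ⟨t', by omega, h4, ?_⟩
      rw [h5, E.history_succ, h2]
      simp
  have fair : E.Fair e := by
    intro n
    obtain ⟨t, h1, h2, -⟩ := drain _ n rfl
    exact ⟨t, h1, (perm t).2 h2⟩
  refine ⟨?_, .inl fair⟩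
  -- Either the environment spoils a legal history, and the machine wins at once, or all environment
  -- moves may be assumed legal.
  by_cases hill : ∃ t m, (E.conf e t).2 = [] ∧ e t = some m ∧ E.history e t ∈ G.legalPos ∧
      E.history e t ++ [(.bot, m)] ∉ G.legalPos
  · obtain ⟨t, m, h1, h2, h3, h4⟩ := hill
    have h5 := E.history_succ e t
    rw [(step_some t m h1 h2).2] at h5
    have h6 := (E.isLimit_history e).take_length t
    have h7 := (E.isLimit_history e).take_length (t + 1)
    rw [h5] at h7
    refine G.winner_of_illegal .bot _ ⟨(E.history e t).length, m, ?_, ?_, ?_⟩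
    · rw [h6]; exact h3
    · exact (E.isLimit_history e _ _).2 ⟨t + 1, by rw [h5]; simp⟩
    · simp only [Option.toList_some, List.length_append, List.length_singleton] at h7
      rw [h7]
      exact h4
  · push Not at hill
    set Ψ : ℕ → Position := fun t => E.history e t ++ (E.conf e t).2.map (Prod.mk .top) with hΨ
    -- The chain condition is carried along, because it needs the same analysis of a computation
    -- step; emitting a pending move leaves Ψ unchanged.
    have inv : ∀ t, Inv (E.conf e t).1 (Ψ t) ∧ (0 < t → Ψ (t - 1) <+: Ψ t) := by
      intro t
      induction t with
      | zero => exact ⟨hnil, by simp⟩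
      | succ t ih =>
        simp only [hΨ, Nat.add_sub_cancel, E.history_succ] at ih ⊢
        cases hq : (E.conf e t).2 with
        | nil =>
          rw [hq] at ih
          simp only [List.map_nil, List.append_nil] at ih ⊢
          cases he : e t with
          | none =>
            obtain ⟨h1, h2⟩ := step_none t hq he
            rw [h1, h2, hq]
            simpa using ih.1
          | some m =>
            obtain ⟨h1, h2⟩ := step_some t m hq he
            rw [h1, h2]
            have := hstep _ _ m ih.1 (hill t m hq he (hlegal _ _ ih.1))
            simpa [List.append_assoc] using this
        | cons m q =>
          rw [hq] at ih
          obtain ⟨h1, h2⟩ := step_out t m q hq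
          rw [h1, h2]
          simpa using ih.1
    have chain : IsChain Ψ := isChain_of_succ fun t => (inv (t + 1)).2 (by omega)
    refine hwin Ψ _ chain ?_ fun t => ⟨_, (inv t).1⟩
    -- Each history is an initial segment of Ψ, and Ψ t becomes a history once the queue is drained.
    refine (E.isLimit_history e).cofinal (fun t => ⟨t, List.prefix_append _ _⟩) fun t => ?_
    obtain ⟨t', -, -, h3⟩ := drain _ t rfl
    exact ⟨t', by rw [h3]⟩

/-! ### Machines for implications -/

/-- The reaction of a machine playing an implication, given its reactions (in the other component) to
the moves made in the antecedent and to those made in the consequent. -/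
def impReact {S : Type} (react₁ react₂ : S → Move → S × List Move) (s : S) (m : Move) :
    S × List Move :=
  if m.take 2 = [.bit true, .dot] then
    ((react₁ s (m.drop 2)).1, (react₁ s (m.drop 2)).2.map fun x => [.two, .dot] ++ x)
  else if m.take 2 = [.two, .dot] then
    ((react₂ s (m.drop 2)).1, (react₂ s (m.drop 2)).2.map fun x => [.bit true, .dot] ++ x)
  -- Only moves illegal in the implication get here, so the answer is immaterial.
  else (s, [])

theorem primrec_impReact {S : Type} [Primcodable S] {react₁ react₂ : S → Move → S × List Move}
    (h₁ : Primrec₂ react₁) (h₂ : Primrec₂ react₂) : Primrec₂ (impReact react₁ react₂) := by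
  have htake : Primrec fun a : S × Move => a.2.take 2 :=
    Primrec.list_take.comp (Primrec.const 2) Primrec.snd
  have hdrop : Primrec fun a : S × Move => a.2.drop 2 :=
    Primrec.list_drop.comp (Primrec.const 2) Primrec.snd
  have aux : ∀ {f : S → Move → S × List Move}, Primrec₂ f → ∀ c : Move,
      Primrec fun a : S × Move =>
        ((f a.1 (a.2.drop 2)).1, (f a.1 (a.2.drop 2)).2.map fun x => c ++ x) := by
    intro f hf c
    have hf' := hf.comp Primrec.fst hdrop
    exact Primrec.pair (Primrec.fst.comp hf') (Primrec.list_map (Primrec.snd.comp hf')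
      (Primrec.list_append.comp₂ (Primrec₂.const c) Primrec₂.right))
  exact Primrec.ite (Primrec.eq.comp htake (Primrec.const _)) (aux h₁ _)
    (Primrec.ite (Primrec.eq.comp htake (Primrec.const _)) (aux h₂ _)
      (Primrec.pair Primrec.fst (Primrec.const [])))

/-- The position in the antecedent of an implication, seen as a position of the negated game. -/
def antecedent (Φ : Position) : Position :=
  (Φ.filterMap (component (.bit true))).map Labmove.flip

/-- The position in the consequent of an implication. -/
def consequent (Φ : Position) : Position := Φ.filterMap (component .two)

theorem imp_mem_legalPos {A B : Game} {Φ : Position} : Φ ∈ (A.imp B).legalPos ↔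
    (∀ l ∈ Φ, ∃ α : Move, l.2 = .bit true :: .dot :: α ∨ l.2 = .two :: .dot :: α) ∧
      antecedent Φ ∈ A.legalPos ∧ consequent Φ ∈ B.legalPos := Iff.rfl

theorem antecedent_append (Φ Ψ : Position) :
    antecedent (Φ ++ Ψ) = antecedent Φ ++ antecedent Ψ := by
  simp [antecedent]

theorem consequent_append (Φ Ψ : Position) :
    consequent (Φ ++ Ψ) = consequent Φ ++ consequent Ψ := by
  simp [consequent]

theorem antecedent_map (p : Player) (q : List Move) :
    antecedent ((q.map fun x => [.bit true, .dot] ++ x).map (Prod.mk p)) =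
      q.map (Prod.mk p.adv) := by
  induction q with
  | nil => rfl
  | cons x q ih =>
    rw [List.map_cons, List.map_cons, ← List.singleton_append, antecedent_append, ih]
    rfl

theorem consequent_map_one (p : Player) (q : List Move) :
    consequent ((q.map fun x => [.bit true, .dot] ++ x).map (Prod.mk p)) = [] := by
  simp [consequent, component]

theorem consequent_map (p : Player) (q : List Move) :
    consequent ((q.map fun x => [.two, .dot] ++ x).map (Prod.mk p)) = q.map (Prod.mk p) := by
  induction q with
  | nil => rfl
  | cons x q ih =>
    rw [List.map_cons, List.map_cons, ← List.singleton_append, consequent_append, ih]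
    rfl

theorem antecedent_map_two (p : Player) (q : List Move) :
    antecedent ((q.map fun x => [.two, .dot] ++ x).map (Prod.mk p)) = [] := by
  simp [antecedent, component]

/-- Since `antecedent` flips labels, the environment acts as `top` in A and as `bot` in B, and the
machine conversely. The machine wins the disjunction as soon as a `bot`-win in B forces a `bot`-win
in A. -/
theorem imp_wins {S : Type} [Primcodable S] {s₀ : S} {react₁ react₂ : S → Move → S × List Move}
    (h₁ : Primrec₂ react₁) (h₂ : Primrec₂ react₂) {A B : Game}
    (Inv : S → Position → Position → Prop) (hnil : Inv s₀ [] [])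
    (hlegal : ∀ s X Y, Inv s X Y → X ∈ A.legalPos ∧ Y ∈ B.legalPos)
    (hstep₁ : ∀ s X Y m, Inv s X Y → X ++ [(.top, m)] ∈ A.legalPos →
      Inv (react₁ s m).1 (X ++ [(.top, m)]) (Y ++ (react₁ s m).2.map (Prod.mk .top)))
    (hstep₂ : ∀ s X Y m, Inv s X Y → Y ++ [(.bot, m)] ∈ B.legalPos →
      Inv (react₂ s m).1 (X ++ (react₂ s m).2.map (Prod.mk .bot)) (Y ++ [(.bot, m)]))
    (hwin : ∀ X Y Γ Δ, IsChain X → IsChain Y → IsLimit X Γ → IsLimit Y Δ →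
      (∀ t, ∃ s, Inv s (X t) (Y t)) → B.winner Δ = .bot → A.winner Γ = .bot) :
    (reactiveEPM s₀ (impReact react₁ react₂) (primrec_impReact h₁ h₂)).Wins (A.imp B) := by
  refine reactiveEPM_wins _ (fun s Φ => (∀ l ∈ Φ, ∃ α : Move, l.2 = .bit true :: .dot :: α ∨
    l.2 = .two :: .dot :: α) ∧ Inv s (antecedent Φ) (consequent Φ)) ?_ ?_ ?_ ?_
  · exact ⟨by simp, hnil⟩
  · rintro s Φ ⟨h, hI⟩
    exact ⟨h, hlegal _ _ _ hI⟩
  · rintro s Φ m ⟨h, hI⟩ hm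
    rw [imp_mem_legalPos] at hm
    obtain ⟨hform, hA, hB⟩ := hm
    obtain ⟨α, hα⟩ := hform (.bot, m) (by simp)
    rw [show ∀ q : Position, Φ ++ (.bot, m) :: q = Φ ++ ([(.bot, m)] ++ q) by simp]
    rw [antecedent_append] at hA
    rw [consequent_append] at hB
    rcases hα with hα | hα <;> simp only at hα <;> subst hα
    · have e1 : antecedent [(.bot, .bit true :: .dot :: α)] = [(.top, α)] :=
        antecedent_map .bot [α]
      have e2 : consequent [(.bot, .bit true :: .dot :: α)] = [] := consequent_map_one .bot [α]
      rw [e1] at hA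
      rw [show impReact react₁ react₂ s (.bit true :: .dot :: α) = ((react₁ s α).1,
        (react₁ s α).2.map fun x => [.two, .dot] ++ x) from rfl]
      refine ⟨?_, ?_⟩
      · intro l hl
        simp only [List.mem_append, List.mem_map, List.mem_singleton] at hl
        rcases hl with hl | rfl | ⟨_, ⟨x, -, rfl⟩, rfl⟩
        · exact h l hl
        · exact ⟨_, .inl rfl⟩
        · exact ⟨x, .inr rfl⟩
      · rw [antecedent_append, antecedent_append, consequent_append, consequent_append, e1, e2,
          antecedent_map_two, consequent_map, List.append_nil, List.nil_append]
        exact hstep₁ _ _ _ _ hI hA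
    · have e1 : antecedent [(.bot, .two :: .dot :: α)] = [] := antecedent_map_two .bot [α]
      have e2 : consequent [(.bot, .two :: .dot :: α)] = [(.bot, α)] := consequent_map .bot [α]
      rw [e2] at hB
      rw [show impReact react₁ react₂ s (.two :: .dot :: α) = ((react₂ s α).1,
        (react₂ s α).2.map fun x => [.bit true, .dot] ++ x) from rfl]
      refine ⟨?_, ?_⟩
      · intro l hl
        simp only [List.mem_append, List.mem_map, List.mem_singleton] at hl
        rcases hl with hl | rfl | ⟨_, ⟨x, -, rfl⟩, rfl⟩
        · exact h l hl
        · exact ⟨_, .inr rfl⟩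
        · exact ⟨x, .inl rfl⟩
      · rw [antecedent_append, antecedent_append, consequent_append, consequent_append, e1, e2,
          antecedent_map, consequent_map_one, List.append_nil, List.nil_append]
        exact hstep₂ _ _ _ _ hI hB
  · intro Ψ Γ hc hl hI
    have hleg : (A.imp B).Legal Γ := hl.legal hc fun t => by
      obtain ⟨s, h, hs⟩ := hI t
      exact ⟨h, hlegal _ _ _ hs⟩
    refine (ofOutcome_winner hleg).trans ?_
    rw [if_pos]
    by_contra hcon
    rw [not_or] at hcon
    have notTop : ∀ {p : Player}, p ≠ .top → p = .bot := by rintro ⟨⟩ h <;> simp_all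
    have hb := hwin (fun t => antecedent (Ψ t)) (fun t => consequent (Ψ t)) _ _
      ((hc.filterMap _).map _) (hc.filterMap _) ((hl.filterMap hc _).map _) (hl.filterMap hc _)
      (fun t => ⟨_, (hI t).choose_spec.2⟩) (notTop hcon.2)
    refine hcon.1 ?_
    change (A.winner _).adv = _
    rw [hb]
    rfl

/-! ### Computability of the operations on moves -/

theorem primrec_bit : Primrec Key.bit :=
  (Primrec.of_equiv_symm (e := Key.equivSum)).comp Primrec.sumInl

theorem primrec_switch : Primrec switch :=
  Primrec.list_map Primrec.id (primrec_bit.comp₂ Primrec₂.right)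

theorem primrec_replicate : Primrec replicate :=
  Primrec.list_append.comp primrec_switch (Primrec.const _)

theorem primrec_inNode : Primrec₂ inNode :=
  Primrec.list_append.comp₂ (primrec_switch.comp₂ Primrec₂.left)
    (Primrec.list_cons.comp₂ (Primrec₂.const _) Primrec₂.right)

/-- The bit that a symbol is, if any. -/
def Key.toBit? (k : Key) : Option Bool := (Key.equivSum k).elim some fun _ => none

theorem primrec_toBit? : Primrec Key.toBit? := by
  refine (Primrec.sumCasesOn (Primrec.of_equiv (e := Key.equivSum))
    (Primrec.option_some.comp₂ Primrec₂.right) (Primrec₂.const none)).of_eq fun k => ?_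
  rw [Key.toBit?]
  cases Key.equivSum k <;> rfl

theorem primrec_parse : Primrec parse := by
  have hhead : Primrec fun x : Move × Key × Move × (List Bool × Move) => x.2.1.toBit? :=
    primrec_toBit?.comp (Primrec.fst.comp Primrec.snd)
  have hcons : Primrec fun x : Move × Key × Move × (List Bool × Move) =>
      (([], x.2.1 :: x.2.2.1) : List Bool × Move) :=
    Primrec.pair (Primrec.const [])
      (Primrec.list_cons.comp (Primrec.fst.comp Primrec.snd)
        (Primrec.fst.comp (Primrec.snd.comp Primrec.snd)))
  have hih : Primrec₂ fun (x : Move × Key × Move × (List Bool × Move)) (b : Bool) =>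
      ((b :: x.2.2.2.1, x.2.2.2.2) : List Bool × Move) := by
    have h3 : Primrec fun y : (Move × Key × Move × (List Bool × Move)) × Bool => y.1.2.2.2 :=
      Primrec.snd.comp (Primrec.snd.comp (Primrec.snd.comp Primrec.fst))
    exact Primrec.pair (Primrec.list_cons.comp Primrec.snd (Primrec.fst.comp h3))
      (Primrec.snd.comp h3)
  refine (Primrec.list_rec (h := fun (_ : Move) (x : Key × Move × (List Bool × Move)) =>
    Option.casesOn (motive := fun _ => List Bool × Move) x.1.toBit? ([], x.1 :: x.2.1)
      fun b => (b :: x.2.2.1, x.2.2.2)) Primrec.id (Primrec.const (([], []) : List Bool × Move))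
    (Primrec.option_casesOn hhead hcons hih)).of_eq fun m => ?_
  induction m with
  | nil => rfl
  | cons k m ih =>
    simp only [id] at ih ⊢
    rw [ih]
    cases k <;> rfl

/-! ### Tight legality -/

theorem IsActual.append {Φ : Position} {v : List Bool} (h : IsActual Φ v) (Ψ : Position) :
    IsActual (Φ ++ Ψ) v := by
  rcases h with h | ⟨u, b, p, h1, h2⟩
  · exact .inl h
  · exact .inr ⟨u, b, p, h1, List.mem_append_left _ h2⟩

theorem isActual_concat_of_ne {Φ : Position} {p : Player} {m : Move} (hm : ∀ w, m ≠ replicate w)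
    {v : List Bool} : IsActual (Φ ++ [(p, m)]) v ↔ IsActual Φ v := by
  refine ⟨?_, fun h => h.append _⟩
  rintro (h | ⟨u, b, q, h1, h2⟩)
  · exact .inl h
  · rcases List.mem_append.1 h2 with h2 | h2
    · exact .inr ⟨u, b, q, h1, h2⟩
    · rw [List.mem_singleton] at h2
      exact absurd (Prod.mk.inj h2).2.symm (hm u)

theorem isActual_concat_replicate {Φ : Position} {p : Player} {w v : List Bool} :
    IsActual (Φ ++ [(p, replicate w)]) v ↔ IsActual Φ v ∨ ∃ b, v = w ++ [b] := by
  constructor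
  · rintro (h | ⟨u, b, q, h1, h2⟩)
    · exact .inl (.inl h)
    · rcases List.mem_append.1 h2 with h2 | h2
      · exact .inl (.inr ⟨u, b, q, h1, h2⟩)
      · rw [List.mem_singleton] at h2
        exact .inr ⟨b, by rw [h1, replicate_injective (Prod.mk.inj h2).2]⟩
  · rintro (h | ⟨b, rfl⟩)
    · exact h.append _
    · exact .inr ⟨w, b, p, rfl, by simp⟩

theorem isOuter_concat_of_ne {Φ : Position} {p : Player} {m : Move} (hm : ∀ w, m ≠ replicate w)
    {v : List Bool} : IsOuter (Φ ++ [(p, m)]) v ↔ IsOuter Φ v := by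
  simp only [IsOuter, isActual_concat_of_ne hm]

namespace TightLegal

variable {A : Game} {Φ : Position}

theorem isActual_of_replicate_mem (h : TightLegal A Φ) {p : Player} {u : List Bool}
    (hu : (p, CoL.replicate u) ∈ Φ) : IsActual Φ u := by
  induction h with
  | nil => simp at hu
  | switch Φ w h1 h2 ih =>
    rcases List.mem_append.1 hu with hu | hu
    · exact (ih hu).append _
    · rw [List.mem_singleton] at hu
      exact absurd (Prod.mk.inj hu).2 (replicate_ne_switch _ _)
  | replicate Φ w h1 h2 ih =>
    rcases List.mem_append.1 hu with hu | hu
    · exact (ih hu).append _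
    · rw [List.mem_singleton] at hu
      rw [replicate_injective (Prod.mk.inj hu).2]
      exact h2.1.append _
  | inNode Φ q w α h1 h2 h3 ih =>
    rcases List.mem_append.1 hu with hu | hu
    · exact (ih hu).append _
    · rw [List.mem_singleton] at hu
      exact absurd (Prod.mk.inj hu).2 (replicate_ne_inNode _ _ _)

/-- Actual nodes form a tree: a nonempty one is a child of a replicated node, which was itself
actual when replicated. -/
theorem isActual_of_prefix (h : TightLegal A Φ) {u v : List Bool} (hv : IsActual Φ v)
    (huv : u <+: v) : IsActual Φ u := by
  induction v using List.reverseRecOn with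
  | nil => rw [List.prefix_nil.1 huv]; exact .inl rfl
  | append_singleton v b ih =>
    rcases List.prefix_concat_iff.1 huv with rfl | huv
    · exact hv
    · refine ih ?_ huv
      rcases hv with hv | ⟨u', b', p, h1, h2⟩
      · simp at hv
      · rw [(List.append_inj' h1 rfl).1]
        exact h.isActual_of_replicate_mem h2

theorem thread_mem (h : TightLegal A Φ) (z : Stream' Bool) :
    Position.thread Φ z ∈ A.legalPos := by
  induction h with
  | nil => exact A.nil_mem
  | switch Φ w h1 h2 ih => rwa [thread_append, thread_switch, List.append_nil]
  | replicate Φ w h1 h2 ih => rwa [thread_append, thread_replicate, List.append_nil]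
  | inNode Φ q w α h1 h2 h3 ih =>
    rw [thread_append, thread_inNode]
    split_ifs with hw
    · rw [hw.eq_append]
      exact h3 _
    · rwa [List.append_nil]

theorem concat_cases {p : Player} {m : Move} (h : TightLegal A (Φ ++ [(p, m)])) :
    TightLegal A Φ ∧ ((p = .bot ∧ ∃ w, m = CoL.switch w ∧ IsActual Φ w) ∨
      (p = .bot ∧ ∃ w, m = CoL.replicate w ∧ IsOuter Φ w) ∨
      ∃ w α, m = CoL.inNode w α ∧ IsActual Φ w ∧
        ∀ v : Stream' Bool, Position.thread Φ (w ++ₛ v) ++ [(p, α)] ∈ A.legalPos) := by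
  generalize hΨ : Φ ++ [(p, m)] = Ψ at h
  cases h with
  | nil => simp at hΨ
  | switch Φ' w h1 h2 =>
    obtain ⟨rfl, h3⟩ := List.append_inj' hΨ rfl
    obtain ⟨rfl, rfl⟩ := Prod.mk.inj (List.singleton_inj.1 h3)
    exact ⟨h1, .inl ⟨rfl, w, rfl, h2⟩⟩
  | replicate Φ' w h1 h2 =>
    obtain ⟨rfl, h3⟩ := List.append_inj' hΨ rfl
    obtain ⟨rfl, rfl⟩ := Prod.mk.inj (List.singleton_inj.1 h3)
    exact ⟨h1, .inr (.inl ⟨rfl, w, rfl, h2⟩)⟩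
  | inNode Φ' q w α h1 h2 h3 =>
    obtain ⟨rfl, h4⟩ := List.append_inj' hΨ rfl
    obtain ⟨rfl, rfl⟩ := Prod.mk.inj (List.singleton_inj.1 h4)
    exact ⟨h1, .inr (.inr ⟨w, α, rfl, h2, h3⟩)⟩

end TightLegal

/-! ### Loose legality -/

theorem looseRec_mem_legalPos {A : Game} {Φ : Position} : Φ ∈ A.looseRec.legalPos ↔
    (∀ l ∈ Φ, (∃ w, l = (.bot, switch w)) ∨ ∃ p w α, l = (p, inNode w α)) ∧
      ∀ v : Stream' Bool, Position.thread Φ v ∈ A.legalPos := Iff.rfl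

theorem tightRec_winner {A : Game} {Γ : Run} (h : A.tightRec.Legal Γ) :
    A.tightRec.winner Γ = recOutcome A Γ := ofOutcome_winner h

theorem looseRec_winner {A : Game} {Γ : Run} (h : A.looseRec.Legal Γ) :
    A.looseRec.winner Γ = recOutcome A Γ := ofOutcome_winner h

theorem switches_inNode (p : Player) (w : List Bool) (α : Move) :
    switches [(p, inNode w α)] = [] := by
  rw [switches_eq_nil]
  intro u hu
  exact switch_ne_inNode _ _ _ (Prod.mk.inj (List.mem_singleton.1 hu)).2

theorem switches_replicate (p : Player) (w : List Bool) : switches [(p, replicate w)] = [] := by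
  rw [switches_eq_nil]
  intro u hu
  exact replicate_ne_switch _ _ (Prod.mk.inj (List.mem_singleton.1 hu)).2.symm

/-! ### Tight recurrence implies loose recurrence -/

/-- The proper initial segments of `w` that do not belong to `s`, in the order of their length. -/
def newNodes (s : List (List Bool)) (w : List Bool) : List (List Bool) :=
  ((List.range w.length).map fun i => w.take i).filter fun u => ∀ x ∈ s, x ≠ u

/-- The reaction to a move made in the tight antecedent: it is copied in the loose consequent. -/
def tightCopy (s : List (List Bool)) (m : Move) : List (List Bool) × List Move := (s, [m])

/-- The reaction to a move made in the loose consequent: the node is made actual in the tight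
antecedent and the move is copied. Here `s` lists the replicated nodes. -/
def looseCopy (s : List (List Bool)) (m : Move) : List (List Bool) × List Move :=
  (s ++ newNodes s (parse m).1, (newNodes s (parse m).1).map replicate ++ [m])

theorem primrec_newNodes : Primrec₂ newNodes := by
  have h1 : PrimrecRel fun (u : List Bool) (s : List (List Bool)) => ∀ x ∈ s, x ≠ u :=
    (PrimrecRel.forall_mem_list Primrec.eq.not).swap
  have h2 : Primrec fun w : List Bool => (List.range w.length).map fun i => w.take i :=
    Primrec.list_map (Primrec.list_range.comp Primrec.list_length)
      (Primrec.list_take.comp₂ Primrec₂.right Primrec₂.left)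
  exact (PrimrecRel.listFilter h1).comp (h2.comp Primrec.snd) Primrec.fst

theorem primrec_tightCopy : Primrec₂ tightCopy :=
  Primrec₂.pair.comp₂ Primrec₂.left
    (Primrec.list_cons.comp₂ Primrec₂.right (Primrec₂.const []))

theorem primrec_looseCopy : Primrec₂ looseCopy := by
  have h : Primrec₂ fun (s : List (List Bool)) (m : Move) => newNodes s (parse m).1 :=
    primrec_newNodes.comp₂ Primrec₂.left ((Primrec.fst.comp primrec_parse).comp₂ Primrec₂.right)
  refine Primrec₂.pair.comp₂ (Primrec.list_append.comp₂ Primrec₂.left h)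
    (Primrec.list_append.comp₂ ?_ (Primrec.list_cons.comp₂ Primrec₂.right (Primrec₂.const [])))
  exact (Primrec.list_map Primrec.id (primrec_replicate.comp₂ Primrec₂.right)).comp₂ h

/-- Induction on the last bit: passing from w to a child adds at most the replication of w. This is
legal because an actual proper extension of w would make a child of w actual, so w would have been
replicated already. -/
theorem TightLegal.append_newNodes {A : Game} {X : Position} {s : List (List Bool)}
    (hX : TightLegal A X) (hs : ∀ u, u ∈ s ↔ ∃ p, (p, CoL.replicate u) ∈ X) (w : List Bool) :
    TightLegal A (X ++ ((newNodes s w).map CoL.replicate).map (Prod.mk .bot)) ∧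
      IsActual (X ++ ((newNodes s w).map CoL.replicate).map (Prod.mk .bot)) w := by
  induction w using List.reverseRecOn with
  | nil => simpa [newNodes] using ⟨hX, Or.inl rfl⟩
  | append_singleton w b ih =>
    have hnew : newNodes s (w ++ [b]) = newNodes s w ++ if w ∈ s then [] else [w] := by
      have h1 : ((List.range (w ++ [b]).length).map fun i => (w ++ [b]).take i) =
          ((List.range w.length).map fun i => w.take i) ++ [w] := by
        rw [List.length_append, List.length_singleton, List.range_succ, List.map_append]
        congr 1
        · refine List.map_congr_left fun i hi => ?_
          rw [List.take_append_of_le_length (List.mem_range.1 hi).le]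
        · simp
      rw [newNodes, h1, List.filter_append, newNodes]
      congr 1
      by_cases hw : w ∈ s
      · rw [if_pos hw, List.filter_eq_nil_iff]
        simpa using hw
      · rw [if_neg hw, List.filter_eq_self]
        simp only [List.mem_singleton, ne_eq, decide_eq_true_eq, forall_eq]
        rintro x hx rfl
        exact hw hx
    obtain ⟨ih1, ih2⟩ := ih
    rw [hnew]
    by_cases hw : w ∈ s
    · rw [if_pos hw, List.append_nil]
      obtain ⟨p, hp⟩ := (hs w).1 hw
      exact ⟨ih1, .inr ⟨w, b, p, rfl, List.mem_append_left _ hp⟩⟩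
    · rw [if_neg hw, List.map_append, List.map_append, ← List.append_assoc]
      refine ⟨ih1.replicate _ w ⟨ih2, ?_⟩, isActual_concat_replicate.2 (.inr ⟨b, rfl⟩)⟩
      rintro u hu ⟨t, rfl⟩
      cases t with
      | nil => simp
      | cons c t =>
        exfalso
        have h1 := ih1.isActual_of_prefix hu (u := w ++ [c]) ⟨t, by simp⟩
        rcases h1 with h1 | ⟨u', b', p, h1, h2⟩
        · simp at h1
        · rw [← (List.append_inj' h1 rfl).1] at h2
          rcases List.mem_append.1 h2 with h2 | h2
          · exact hw ((hs w).2 ⟨p, h2⟩)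
          · simp only [List.map_map, List.mem_map, Function.comp_apply] at h2
            obtain ⟨u'', h3, h4⟩ := h2
            rw [replicate_injective (Prod.mk.inj h4).2] at h3
            simp only [newNodes, List.mem_filter, List.mem_map, List.mem_range] at h3
            -- The nodes replicated just before are strictly shorter than w, so w is not among them.
            obtain ⟨⟨i, hi, h5⟩, -⟩ := h3
            have := congrArg List.length h5
            simp at this
            omega

theorem thread_replicates (q : List (List Bool)) (z : Stream' Bool) :
    Position.thread ((q.map replicate).map (Prod.mk .bot)) z = [] := by
  simp [Position.thread, stripLab, strip_replicate]

theorem switches_replicates (q : List (List Bool)) :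
    switches ((q.map replicate).map (Prod.mk .bot)) = [] := by
  rw [switches_eq_nil]
  intro u hu
  simp only [List.map_map, List.mem_map, Function.comp_apply] at hu
  obtain ⟨w, -, h⟩ := hu
  exact replicate_ne_switch _ _ (Prod.mk.inj h).2

/-- The invariant of the machine for tight-to-loose implication. -/
structure TightLooseInv (A : Game) (s : List (List Bool)) (X Y : Position) : Prop where
  tight : TightLegal A X
  -- Only the shape of the moves in Y is recorded; legality of its threads is inherited from X.
  form : ∀ l ∈ Y, (∃ w, l = (.bot, switch w)) ∨ ∃ p w α, l = (p, inNode w α)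
  mem_iff : ∀ u, u ∈ s ↔ ∃ p, (p, replicate u) ∈ X
  thread_eq : ∀ z, Position.thread X z = Position.thread Y z
  switches_eq : switches X = switches Y

namespace TightLooseInv

variable {A : Game} {s : List (List Bool)} {X Y : Position}

theorem legal (h : TightLooseInv A s X Y) : X ∈ A.tightRec.legalPos ∧ Y ∈ A.looseRec.legalPos :=
  ⟨h.tight, h.form, fun z => by rw [← h.thread_eq]; exact h.tight.thread_mem z⟩

theorem step_antecedent (h : TightLooseInv A s X Y) {m : Move}
    (hm : TightLegal A (X ++ [(.top, m)])) :
    TightLooseInv A s (X ++ [(.top, m)]) (Y ++ [(.top, m)]) := by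
  obtain ⟨-, ⟨h1, -⟩ | ⟨h1, -⟩ | ⟨w, α, rfl, -, -⟩⟩ := hm.concat_cases
  · cases h1
  · cases h1
  refine ⟨hm, ?_, ?_, ?_, ?_⟩
  · intro l hl
    rcases List.mem_append.1 hl with hl | hl
    · exact h.form l hl
    · exact .inr ⟨_, _, _, List.mem_singleton.1 hl⟩
  · intro u
    rw [h.mem_iff]
    refine exists_congr fun p => ⟨List.mem_append_left _, fun hp => ?_⟩
    rcases List.mem_append.1 hp with hp | hp
    · exact hp
    · exact absurd (Prod.mk.inj (List.mem_singleton.1 hp)).2 (replicate_ne_inNode _ _ _)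
  · intro z
    rw [thread_append, thread_append, h.thread_eq]
  · rw [switches_append, switches_append, h.switches_eq]

theorem step_consequent (h : TightLooseInv A s X Y) {m : Move}
    (hm : Y ++ [(.bot, m)] ∈ A.looseRec.legalPos) :
    TightLooseInv A (looseCopy s m).1 (X ++ (looseCopy s m).2.map (Prod.mk .bot))
      (Y ++ [(.bot, m)]) := by
  obtain ⟨hform, hth⟩ := looseRec_mem_legalPos.1 hm
  simp only [looseCopy]
  rw [List.map_append, ← List.append_assoc, List.map_singleton]
  obtain ⟨h1, h2⟩ := h.tight.append_newNodes h.mem_iff (parse m).1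
  have hthr : ∀ z, Position.thread
      (X ++ ((newNodes s (parse m).1).map replicate).map (Prod.mk .bot)) z =
        Position.thread Y z := by
    intro z
    rw [thread_append, thread_replicates, List.append_nil, h.thread_eq]
  have hm' : (∃ w, m = switch w) ∨ ∃ w α, m = inNode w α := by
    rcases hform (.bot, m) (by simp) with ⟨w, hw⟩ | ⟨p, w, α, hw⟩
    · exact .inl ⟨w, (Prod.mk.inj hw).2⟩
    · exact .inr ⟨w, α, (Prod.mk.inj hw).2⟩
  refine ⟨?_, hform, ?_, ?_, ?_⟩
  · rcases hm' with ⟨w, rfl⟩ | ⟨w, α, rfl⟩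
    · rw [parse_switch] at *
      exact .switch _ w h1 h2
    · rw [parse_inNode] at *
      -- The tight condition on all continuations of w is loose legality of the threads through w.
      refine .inNode _ _ w α h1 h2 fun v => ?_
      have := hth (w ++ₛ v)
      rwa [thread_append, thread_inNode, if_pos (onStream_append _ _), ← hthr] at this
  · intro u
    have hne : ∀ p, (p, replicate u) ≠ (Player.bot, m) := by
      intro p hp
      rcases hm' with ⟨w, rfl⟩ | ⟨w, α, rfl⟩
      · exact replicate_ne_switch _ _ (Prod.mk.inj hp).2
      · exact replicate_ne_inNode _ _ _ (Prod.mk.inj hp).2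
    simp only [List.mem_append, h.mem_iff, List.mem_singleton, hne, or_false, exists_or]
    refine or_congr Iff.rfl ?_
    simp only [List.map_map, List.mem_map, Function.comp_apply]
    constructor
    · exact fun hu => ⟨.bot, u, hu, rfl⟩
    · rintro ⟨p, u', hu', h3⟩
      rwa [← replicate_injective (Prod.mk.inj h3).2]
  · intro z
    rw [thread_append, hthr, thread_append]
  · rw [switches_append, switches_append, switches_replicates, List.append_nil,
      switches_append, h.switches_eq]

end TightLooseInv

theorem uniformlyValid_tight_imp_loose :
    UniformlyValid fun P => (Game.tightRec P).imp (Game.looseRec P) := by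
  refine ⟨_, fun A _ => imp_wins (s₀ := []) primrec_tightCopy primrec_looseCopy
    (TightLooseInv A) ⟨.nil, by simp, by simp, fun _ => rfl, rfl⟩ (fun _ _ _ h => h.legal)
    (fun _ _ _ _ h hm => h.step_antecedent hm) (fun _ _ _ _ h hm => h.step_consequent hm) ?_⟩
  intro X Y Γ Δ cX cY hX hY hI hb
  rw [looseRec_winner (hY.legal cY fun t => (hI t).choose_spec.legal.2)] at hb
  rw [tightRec_winner (hX.legal cX fun t => (hI t).choose_spec.legal.1)]
  refine recOutcome_eq_bot_of A hX hY cX cY (fun t => ?_) (fun t => ?_) hb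
  · rw [(hI t).choose_spec.switches_eq]
  · rw [lastSwitch, (hI t).choose_spec.switches_eq, (hI t).choose_spec.thread_eq, lastSwitch]

/-! ### Incomparable bitstrings -/

/-- Neither of the bitstrings is an initial segment of the other one. -/
def Incomp (u v : List Bool) : Prop := ¬ u <+: v ∧ ¬ v <+: u

theorem Incomp.symm {u v : List Bool} (h : Incomp u v) : Incomp v u := ⟨h.2, h.1⟩

/-- Initial segments of one string are comparable, so incomparability survives extension; this keeps
the list an antichain under padding and splitting. -/
theorem Incomp.mono {u v u' v' : List Bool} (h : Incomp u v) (hu : u <+: u') (hv : v <+: v') :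
    Incomp u' v' := by
  constructor
  · intro h'
    rcases List.prefix_or_prefix_of_prefix (hu.trans h') hv with h1 | h1
    · exact h.1 h1
    · exact h.2 h1
  · intro h'
    rcases List.prefix_or_prefix_of_prefix hu (hv.trans h') with h1 | h1
    · exact h.1 h1
    · exact h.2 h1

theorem Incomp.not_onStream {u v : List Bool} (h : Incomp u v) {z : Stream' Bool}
    (hu : OnStream u z) : ¬ OnStream v z := by
  intro hv
  rcases hu.prefix_or_prefix hv with h1 | h1
  · exact h.1 h1
  · exact h.2 h1

theorem incomp_concat (w : List Bool) : Incomp (w ++ [false]) (w ++ [true]) := by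
  constructor <;> intro h <;> simpa using h.eq_of_length (by simp)

/-- A list of nodes of two trees such that different members are incomparable in either tree. -/
def IsAntichainList (L : List (List Bool × List Bool)) : Prop :=
  L.Pairwise fun p q => Incomp p.1 q.1 ∧ Incomp p.2 q.2

namespace IsAntichainList

variable {L : List (List Bool × List Bool)}

theorem incomp (h : IsAntichainList L) {p q : List Bool × List Bool} (hp : p ∈ L) (hq : q ∈ L)
    (hpq : p ≠ q) : Incomp p.1 q.1 ∧ Incomp p.2 q.2 :=
  haveI : Std.Symm fun p q : List Bool × List Bool => Incomp p.1 q.1 ∧ Incomp p.2 q.2 :=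
    ⟨fun _ _ h => ⟨h.1.symm, h.2.symm⟩⟩
  List.Pairwise.forall h hp hq hpq

theorem eq_of_onStream_fst (h : IsAntichainList L) {p q : List Bool × List Bool} (hp : p ∈ L)
    (hq : q ∈ L) {z : Stream' Bool} (h1 : OnStream p.1 z) (h2 : OnStream q.1 z) : p = q := by
  by_contra hpq
  exact (h.incomp hp hq hpq).1.not_onStream h1 h2

theorem eq_of_onStream_snd (h : IsAntichainList L) {p q : List Bool × List Bool} (hp : p ∈ L)
    (hq : q ∈ L) {z : Stream' Bool} (h1 : OnStream p.2 z) (h2 : OnStream q.2 z) : p = q := by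
  by_contra hpq
  exact (h.incomp hp hq hpq).2.not_onStream h1 h2

theorem nodup (h : IsAntichainList L) : L.Nodup := by
  refine List.Pairwise.imp ?_ h
  rintro p q ⟨h1, -⟩ rfl
  exact h1.1 List.prefix_rfl

end IsAntichainList

/-! ### Moves made at a set of pairwise incomparable nodes -/

/-- The position in which player `r` makes the move `α` at each of the listed nodes. -/
def movesAt (r : Player) (α : Move) (U : List (List Bool)) : Position :=
  (U.map fun u => inNode u α).map (Prod.mk r)

theorem movesAt_cons (r : Player) (α : Move) (u : List Bool) (U : List (List Bool)) :
    movesAt r α (u :: U) = [(r, inNode u α)] ++ movesAt r α U := rfl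

theorem switches_movesAt (r : Player) (α : Move) (U : List (List Bool)) :
    switches (movesAt r α U) = [] := by
  induction U with
  | nil => rfl
  | cons u U ih => rw [movesAt_cons, switches_append, switches_inNode, ih]; rfl

/-- At most one of the incomparable nodes lies on z, so α enters the thread at most once. -/
theorem thread_movesAt (r : Player) (α : Move) {U : List (List Bool)} (hU : U.Pairwise Incomp)
    (z : Stream' Bool) : Position.thread (movesAt r α U) z =
      open Classical in if ∃ u ∈ U, OnStream u z then [(r, α)] else [] := by
  induction U with
  | nil => simp [movesAt, Position.thread]
  | cons u U ih =>
    rw [List.pairwise_cons] at hU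
    rw [movesAt_cons, thread_append, thread_inNode, ih hU.2]
    by_cases hu : OnStream u z
    · have : ¬ ∃ v ∈ U, OnStream v z := by
        rintro ⟨v, hv, hz⟩
        exact (hU.1 v hv).not_onStream hu hz
      rw [if_pos hu, if_neg this, if_pos ⟨u, by simp, hu⟩, List.append_nil]
    · simp [hu]

theorem isActual_append_movesAt {Φ : Position} {r : Player} {α : Move} {U : List (List Bool)}
    {v : List Bool} : IsActual (Φ ++ movesAt r α U) v ↔ IsActual Φ v := by
  induction U generalizing Φ with
  | nil => simp [movesAt]
  | cons u U ih =>
    rw [movesAt_cons, ← List.append_assoc, ih,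
      isActual_concat_of_ne fun w => (replicate_ne_inNode _ _ _).symm]

/-- A move at one node leaves the threads through the other nodes unchanged, so legality can be
checked in Φ for all moves at once. -/
theorem TightLegal.append_movesAt {A : Game} {Φ : Position} (h : TightLegal A Φ) {r : Player}
    {α : Move} {U : List (List Bool)} (hU : U.Pairwise Incomp) (hact : ∀ u ∈ U, IsActual Φ u)
    (hleg : ∀ u ∈ U, ∀ z, Position.thread Φ (u ++ₛ z) ++ [(r, α)] ∈ A.legalPos) :
    TightLegal A (Φ ++ movesAt r α U) := by
  induction U generalizing Φ with
  | nil => simpa [movesAt] using h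
  | cons u U ih =>
    rw [List.pairwise_cons] at hU
    rw [movesAt_cons, ← List.append_assoc]
    refine ih (h.inNode _ r u α (hact u (by simp)) (hleg u (by simp))) hU.2
      (fun v hv => (hact v (by simp [hv])).append _) fun v hv z => ?_
    rw [thread_append, thread_inNode, if_neg, List.append_nil]
    · exact hleg v (by simp [hv]) z
    · exact (hU.1 v hv).symm.not_onStream (onStream_append _ _)

/-! ### Extensions by zeros -/

theorem zeroExt_concat (v : List Bool) : zeroExt (v ++ [false]) = zeroExt v := by
  rw [zeroExt, Stream'.append_append_stream, zeroExt]
  congr 1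
  exact (Stream'.const_eq false).symm

theorem zeroExt_append_map {α : Type*} (v : List Bool) (m : List α) :
    zeroExt (v ++ m.map fun _ => false) = zeroExt v := by
  induction m using List.reverseRecOn with
  | nil => simp
  | append_singleton m a ih =>
    rw [List.map_append, ← List.append_assoc]
    exact (zeroExt_concat _).trans ih

theorem zeroExt_eq_of_onStream {v w : List Bool} (h : OnStream v (zeroExt w)) (hw : w <+: v) :
    zeroExt v = zeroExt w := by
  obtain ⟨t, rfl⟩ := hw
  rw [h.eq_append, zeroExt]
  congr 1
  rw [List.length_append, ← Stream'.drop_drop, zeroExt, Stream'.drop_append_stream,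
    Stream'.drop_const]

/-- As many zeros as v has bits suffice; this gives the finite, computable test used in
`tightReact`. -/
theorem onStream_zeroExt_iff (v w : List Bool) :
    OnStream v (zeroExt w) ↔ v <+: w ++ v.map fun _ => false := by
  rw [← zeroExt_append_map w v, zeroExt, onStream_append_iff _ (by simp)]

/-! ### Loose recurrence implies tight recurrence -/

/-- Lengthen the nodes of the loose tree by as many zeros as the move `m` has symbols. -/
def pad (L : List (List Bool × List Bool)) (m : Move) : List (List Bool × List Bool) :=
  L.map fun p => (p.1, p.2 ++ m.map fun _ => false)

/-- Replicate the node `w` of the tight tree. -/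
def split (L : List (List Bool × List Bool)) (w : List Bool) : List (List Bool × List Bool) :=
  L.flatMap fun p => if p.1 = w then
    [(p.1 ++ [false], p.2 ++ [false]), (p.1 ++ [true], p.2 ++ [true])] else [p]

/-- The reaction to a move `x.α` made in the loose antecedent: `α` is made at every outer node of the
tight consequent that is matched with an extension of `x`. A state lists the outer actual nodes of the
tight tree together with the nodes of the loose tree that they are matched with. -/
def looseReact (L : List (List Bool × List Bool)) (m : Move) :
    List (List Bool × List Bool) × List Move :=
  (pad L m, ((pad L m).filter fun p => (parse m).1 <+: p.2).map
    fun p => inNode p.1 (parse m).2.tail)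

/-- The reaction to a move made in the tight consequent. -/
def tightReact (L : List (List Bool × List Bool)) (m : Move) :
    List (List Bool × List Bool) × List Move :=
  -- The cases are switch, replicative and other moves; in the last one `tail` removes the dot. Only
  -- loose moves need padding; here it is harmless.
  if (parse m).2 = [] then
    (pad L m, ((pad L m).filter fun p => p.1 <+: (parse m).1 ++ p.1.map fun _ => false).map
      fun p => switch p.2)
  else if (parse m).2 = [.colon] then (split (pad L m) (parse m).1, [])
  else (pad L m, ((pad L m).filter fun p => (parse m).1 <+: p.1).map
    fun p => inNode p.2 (parse m).2.tail)

/-! ### Primitive recursiveness of the reactions -/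

theorem primrecRel_prefix : PrimrecRel fun u v : List Bool => u <+: v :=
  PrimrecRel.of_eq (Primrec.eq.comp₂ Primrec₂.left
    (Primrec.list_take.comp₂ (Primrec.list_length.comp₂ Primrec₂.left) Primrec₂.right))
    fun _ _ => List.prefix_iff_eq_take.symm

theorem primrec_map_false {α : Type*} [Primcodable α] :
    Primrec fun m : List α => m.map fun _ => false :=
  Primrec.list_map Primrec.id (Primrec₂.const false)

theorem primrec_pad : Primrec₂ pad := by
  refine Primrec.list_map Primrec.fst ?_
  exact Primrec.pair (Primrec.fst.comp Primrec.snd)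
    (Primrec.list_append.comp (Primrec.snd.comp Primrec.snd)
      (primrec_map_false.comp (Primrec.snd.comp Primrec.fst)))

theorem primrec_split : Primrec₂ split := by
  have hc : ∀ b : Bool, Primrec fun x : (List (List Bool × List Bool) × List Bool) ×
      (List Bool × List Bool) => (x.2.1 ++ [b], x.2.2 ++ [b]) := fun b =>
    Primrec.pair
      (Primrec.list_append.comp (Primrec.fst.comp Primrec.snd) (Primrec.const [b]))
      (Primrec.list_append.comp (Primrec.snd.comp Primrec.snd) (Primrec.const [b]))
  refine Primrec.list_flatMap Primrec.fst (Primrec.ite ?_ ?_ ?_)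
  · exact Primrec.eq.comp (Primrec.fst.comp Primrec.snd) (Primrec.snd.comp Primrec.fst)
  · exact Primrec.list_cons.comp (hc false)
      (Primrec.list_cons.comp (hc true) (Primrec.const []))
  · exact Primrec.list_cons.comp Primrec.snd (Primrec.const [])

theorem primrec_select {c : List Bool × List Bool → Move → Prop} [DecidableRel c]
    {f : Move → List Bool × List Bool → Move} (hc : PrimrecRel c) (hf : Primrec₂ f) :
    Primrec₂ fun (L : List (List Bool × List Bool)) (m : Move) =>
      (pad L m, ((pad L m).filter fun p => c p m).map (f m)) := by
  refine Primrec₂.pair.comp₂ primrec_pad ?_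
  refine Primrec.list_map ((PrimrecRel.listFilter hc).comp primrec_pad Primrec.snd) ?_
  exact hf.comp₂ (Primrec.snd.comp₂ Primrec₂.left) Primrec₂.right

theorem primrec_looseReact : Primrec₂ looseReact := by
  have hw : Primrec fun m : Move => (parse m).1 := Primrec.fst.comp primrec_parse
  have hα : Primrec fun m : Move => (parse m).2.tail :=
    Primrec.list_tail.comp (Primrec.snd.comp primrec_parse)
  exact primrec_select (c := fun p m => (parse m).1 <+: p.2)
    (f := fun m p => inNode p.1 (parse m).2.tail)
    (primrecRel_prefix.comp₂ (hw.comp₂ Primrec₂.right) (Primrec.snd.comp₂ Primrec₂.left))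
    (primrec_inNode.comp₂ (Primrec.fst.comp₂ Primrec₂.right) (hα.comp₂ Primrec₂.left))

theorem primrec_tightReact : Primrec₂ tightReact := by
  have hw : Primrec fun m : Move => (parse m).1 := Primrec.fst.comp primrec_parse
  have hr : Primrec fun m : Move => (parse m).2 := Primrec.snd.comp primrec_parse
  refine Primrec.ite (Primrec.eq.comp (hr.comp Primrec.snd) (Primrec.const _)) ?_
    (Primrec.ite (Primrec.eq.comp (hr.comp Primrec.snd) (Primrec.const _)) ?_ ?_)
  · exact primrec_select (c := fun p m => p.1 <+: (parse m).1 ++ p.1.map fun _ => false)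
      (f := fun _ p => switch p.2)
      (primrecRel_prefix.comp₂ (Primrec.fst.comp₂ Primrec₂.left)
        (Primrec.list_append.comp₂ (hw.comp₂ Primrec₂.right)
          (primrec_map_false.comp₂ (Primrec.fst.comp₂ Primrec₂.left))))
      (primrec_switch.comp₂ (Primrec.snd.comp₂ Primrec₂.right))
  · exact Primrec.pair (primrec_split.comp primrec_pad (hw.comp Primrec.snd)) (Primrec.const [])
  · exact primrec_select (c := fun p m => (parse m).1 <+: p.1)
      (f := fun m p => inNode p.2 (parse m).2.tail)
      (primrecRel_prefix.comp₂ (hw.comp₂ Primrec₂.right) (Primrec.fst.comp₂ Primrec₂.left))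
      (primrec_inNode.comp₂ (Primrec.snd.comp₂ Primrec₂.right)
        ((Primrec.list_tail.comp hr).comp₂ Primrec₂.left))

/-- The invariant of the machine for loose-to-tight implication. -/
structure LooseTightInv (A : Game) (L : List (List Bool × List Bool)) (X Y : Position) :
    Prop where
  loose : X ∈ A.looseRec.legalPos
  tight : TightLegal A Y
  antichain : IsAntichainList L
  outer : ∀ p ∈ L, IsOuter Y p.1
  -- No such condition is put on the loose nodes: padding would destroy it.
  cover : ∀ z, ∃ p ∈ L, OnStream p.1 z
  -- The continuations are independent, so the thread is constant below a listed node of either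
  -- tree; this permits padding and splitting.
  thread_eq : ∀ p ∈ L, ∀ z z',
    Position.thread Y (p.1 ++ₛ z) = Position.thread X (p.2 ++ₛ z')
  length_switches : (switches X).length = (switches Y).length
  -- Agreement is only up to trailing zeros, since listed nodes grow after the switch moves to them.
  last : ∃ p ∈ L, zeroExt p.1 = zeroExt (lastSwitch Y) ∧ zeroExt p.2 = zeroExt (lastSwitch X)

namespace LooseTightInv

variable {A : Game} {L : List (List Bool × List Bool)} {X Y : Position}

theorem nil (A : Game) : LooseTightInv A [([], [])] [] [] where
  loose := A.looseRec.nil_mem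
  tight := .nil
  antichain := List.pairwise_singleton _ _
  outer p hp := by
    rw [List.mem_singleton.1 hp]
    refine ⟨.inl rfl, ?_⟩
    rintro u (hu | ⟨_, _, _, -, hu⟩) -
    · exact hu
    · cases hu
  cover z := ⟨_, List.mem_singleton_self _, rfl⟩
  thread_eq _ _ _ _ := rfl
  length_switches := rfl
  last := ⟨_, List.mem_singleton_self _, rfl, rfl⟩

theorem thread_lastSwitch (h : LooseTightInv A L X Y) :
    Position.thread X (zeroExt (lastSwitch X)) = Position.thread Y (zeroExt (lastSwitch Y)) := by
  obtain ⟨p, hp, h1, h2⟩ := h.last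
  rw [← h1, ← h2]
  exact (h.thread_eq p hp _ _).symm

theorem prefix_of_onStream (h : LooseTightInv A L X Y) {p : List Bool × List Bool} (hp : p ∈ L)
    {w : List Bool} (hw : IsActual Y w) {z : Stream' Bool} (h1 : OnStream p.1 z)
    (h2 : OnStream w z) : w <+: p.1 := by
  rcases h2.prefix_or_prefix h1 with h3 | h3
  · exact h3
  · rw [(h.outer p hp).2 w hw h3]

theorem pad (h : LooseTightInv A L X Y) (m : Move) : LooseTightInv A (pad L m) X Y where
  loose := h.loose
  tight := h.tight
  antichain := by
    refine List.pairwise_map.2 (List.Pairwise.imp ?_ h.antichain)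
    rintro p q ⟨h1, h2⟩
    exact ⟨h1, h2.mono (List.prefix_append _ _) (List.prefix_append _ _)⟩
  outer q hq := by
    obtain ⟨p, hp, rfl⟩ := List.mem_map.1 hq
    exact h.outer p hp
  cover z := by
    obtain ⟨p, hp, hz⟩ := h.cover z
    exact ⟨_, List.mem_map_of_mem hp, hz⟩
  thread_eq q hq z z' := by
    obtain ⟨p, hp, rfl⟩ := List.mem_map.1 hq
    simp only
    rw [Stream'.append_append_stream]
    exact h.thread_eq p hp _ _
  length_switches := h.length_switches
  last := by
    obtain ⟨p, hp, h1, h2⟩ := h.last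
    exact ⟨_, List.mem_map_of_mem hp, h1, by rw [zeroExt_append_map, h2]⟩

theorem _root_.CoL.length_le_of_mem_pad {m : Move} {p : List Bool × List Bool}
    (hp : p ∈ CoL.pad L m) : m.length ≤ p.2.length := by
  obtain ⟨q, -, rfl⟩ := List.mem_map.1 hp
  simp

/-- By `hx`, the move at x reaches either all continuations of a listed loose node or none, and it
is repeated exactly at the partners of the nodes reached. -/
theorem append_movesAt_tight (h : LooseTightInv A L X Y) {x : List Bool} {α : Move}
    (hx : ∀ p ∈ L, x.length ≤ p.2.length)
    (hm : X ++ [(.top, inNode x α)] ∈ A.looseRec.legalPos) :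
    LooseTightInv A L (X ++ [(.top, inNode x α)])
      (Y ++ movesAt .top α ((L.filter fun p => x <+: p.2).map Prod.fst)) := by
  set U := (L.filter fun p => x <+: p.2).map Prod.fst with hUdef
  have memU : ∀ u, u ∈ U ↔ ∃ p ∈ L, x <+: p.2 ∧ p.1 = u := by
    intro u
    simp [hUdef, and_assoc]
  have hU : U.Pairwise Incomp := by
    refine List.pairwise_map.2 (List.Pairwise.filter _ ?_)
    exact List.Pairwise.imp (fun h => h.1) h.antichain
  refine ⟨hm, ?_, h.antichain, ?_, h.cover, ?_, ?_, ?_⟩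
  · refine h.tight.append_movesAt hU ?_ ?_
    · intro u hu
      obtain ⟨p, hp, -, rfl⟩ := (memU u).1 hu
      exact (h.outer p hp).1
    · intro u hu z
      obtain ⟨p, hp, h1, rfl⟩ := (memU u).1 hu
      have := (looseRec_mem_legalPos.1 hm).2 (p.2 ++ₛ z)
      rw [thread_append, thread_inNode, if_pos (.of_prefix h1 (onStream_append _ _))] at this
      rwa [h.thread_eq p hp z z]
  · intro p hp
    have := h.outer p hp
    simpa only [IsOuter, isActual_append_movesAt] using this
  · intro p hp z z'
    rw [thread_append, thread_append, thread_movesAt _ _ hU, thread_inNode, h.thread_eq p hp z z']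
    congr 1
    refine if_congr ?_ rfl rfl
    rw [onStream_append_iff _ (hx p hp)]
    constructor
    · rintro ⟨u, hu, hz⟩
      obtain ⟨q, hq, h1, rfl⟩ := (memU u).1 hu
      rwa [h.antichain.eq_of_onStream_fst hp hq (onStream_append _ _) hz]
    · intro h1
      exact ⟨p.1, (memU _).2 ⟨p, hp, h1, rfl⟩, onStream_append _ _⟩
  · rw [switches_append, switches_append, switches_inNode, switches_movesAt, List.append_nil,
      List.append_nil, h.length_switches]
  · rw [lastSwitch_append_of_nil (switches_inNode _ _ _),
      lastSwitch_append_of_nil (switches_movesAt _ _ _)]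
    exact h.last

/-- No length bound is needed: a listed tight node is outer, so an actual w on a stream through it
is an initial segment of it. -/
theorem append_movesAt_loose (h : LooseTightInv A L X Y) {w : List Bool} {α : Move}
    (hw : IsActual Y w) (hm : TightLegal A (Y ++ [(.bot, inNode w α)])) :
    LooseTightInv A L (X ++ movesAt .bot α ((L.filter fun p => w <+: p.1).map Prod.snd))
      (Y ++ [(.bot, inNode w α)]) := by
  set U := (L.filter fun p => w <+: p.1).map Prod.snd with hUdef
  have memU : ∀ u, u ∈ U ↔ ∃ p ∈ L, w <+: p.1 ∧ p.2 = u := by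
    intro u
    simp [hUdef, and_assoc]
  have hU : U.Pairwise Incomp := by
    refine List.pairwise_map.2 (List.Pairwise.filter _ ?_)
    exact List.Pairwise.imp (fun h => h.2) h.antichain
  refine ⟨⟨?_, fun z => ?_⟩, hm, h.antichain, ?_, h.cover, ?_, ?_, ?_⟩
  · intro l hl
    rcases List.mem_append.1 hl with hl | hl
    · exact (looseRec_mem_legalPos.1 h.loose).1 l hl
    · simp only [movesAt, List.map_map, List.mem_map, Function.comp_apply] at hl
      obtain ⟨u, -, rfl⟩ := hl
      exact .inr ⟨_, _, _, rfl⟩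
  · rw [thread_append, thread_movesAt _ _ hU]
    -- A stream through a receiving loose node inherits legality from the tight side; on all others
    -- the thread is unchanged.
    split_ifs with hz
    · obtain ⟨u, hu, hz⟩ := hz
      obtain ⟨p, hp, h1, rfl⟩ := (memU u).1 hu
      have := hm.thread_mem (p.1 ++ₛ z)
      rw [thread_append, thread_inNode, if_pos (.of_prefix h1 (onStream_append _ _))] at this
      rw [hz.eq_append]
      rwa [h.thread_eq p hp _ (z.drop p.2.length)] at this
    · rw [List.append_nil]
      exact (looseRec_mem_legalPos.1 h.loose).2 z
  · intro p hp
    exact (isOuter_concat_of_ne fun w => (replicate_ne_inNode _ _ _).symm).2 (h.outer p hp)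
  · intro p hp z z'
    rw [thread_append, thread_append, thread_movesAt _ _ hU, thread_inNode, h.thread_eq p hp z z']
    congr 1
    refine if_congr ?_ rfl rfl
    constructor
    · intro h1
      exact ⟨p.2, (memU _).2 ⟨p, hp, h.prefix_of_onStream hp hw (onStream_append _ _) h1, rfl⟩,
        onStream_append _ _⟩
    · rintro ⟨u, hu, hz⟩
      obtain ⟨q, hq, h1, rfl⟩ := (memU u).1 hu
      rw [← h.antichain.eq_of_onStream_snd hp hq (onStream_append _ _) hz] at h1
      exact .of_prefix h1 (onStream_append _ _)
  · rw [switches_append, switches_append, switches_inNode, switches_movesAt, List.append_nil,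
      List.append_nil, h.length_switches]
  · rw [lastSwitch_append_of_nil (switches_inNode _ _ _),
      lastSwitch_append_of_nil (switches_movesAt _ _ _)]
    exact h.last

/-- Exactly one listed tight node lies on w000…, by `cover` and `antichain`; hence one switch is
answered by one switch and the counts stay equal. -/
theorem append_switch (h : LooseTightInv A L X Y) {w : List Bool} (hw : IsActual Y w) :
    LooseTightInv A L
      (X ++ ((L.filter fun p => p.1 <+: w ++ p.1.map fun _ => false).map
        fun p => switch p.2).map (Prod.mk .bot)) (Y ++ [(.bot, switch w)]) := by
  obtain ⟨p, hp, hz⟩ := h.cover (zeroExt w)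
  have hfilter : (L.filter fun p => p.1 <+: w ++ p.1.map fun _ => false) = [p] := by
    have : ∀ q ∈ L, decide (q.1 <+: w ++ q.1.map fun _ => false) = decide (q = p) := by
      intro q hq
      rw [decide_eq_decide, ← onStream_zeroExt_iff]
      constructor
      · exact fun hq' => h.antichain.eq_of_onStream_fst hq hp hq' hz
      · rintro rfl
        exact hz
    rw [List.filter_congr this, List.filter_eq, List.count_eq_one_of_mem h.antichain.nodup hp]
    rfl
  rw [hfilter, List.map_singleton, List.map_singleton]
  refine ⟨⟨?_, fun z => ?_⟩, .switch _ _ h.tight hw, h.antichain, ?_, h.cover, ?_, ?_, ?_⟩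
  · intro l hl
    rcases List.mem_append.1 hl with hl | hl
    · exact (looseRec_mem_legalPos.1 h.loose).1 l hl
    · exact .inl ⟨_, List.mem_singleton.1 hl⟩
  · rw [thread_append, thread_switch, List.append_nil]
    exact (looseRec_mem_legalPos.1 h.loose).2 z
  · intro q hq
    exact (isOuter_concat_of_ne fun u => (replicate_ne_switch _ _).symm).2 (h.outer q hq)
  · intro q hq z z'
    rw [thread_append, thread_append, thread_switch, thread_switch, h.thread_eq q hq z z']
  · rw [switches_append, switches_append, switches_switch, switches_switch, List.length_append,
      List.length_append, h.length_switches]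
    rfl
  · refine ⟨p, hp, ?_, ?_⟩
    · rw [lastSwitch_concat]
      exact zeroExt_eq_of_onStream hz (h.prefix_of_onStream hp hw hz (onStream_append _ _))
    · rw [lastSwitch_concat]

/-- Nothing has to be played in the loose tree, as both children of a pair satisfy `thread_eq`
already. -/
theorem append_replicate (h : LooseTightInv A L X Y) {w : List Bool} (hw : IsOuter Y w) :
    LooseTightInv A (split L w) X (Y ++ [(.bot, replicate w)]) := by
  have hmem : ∀ q, q ∈ split L w ↔
      (q ∈ L ∧ q.1 ≠ w) ∨ ∃ p ∈ L, p.1 = w ∧ ∃ b, q = (p.1 ++ [b], p.2 ++ [b]) := by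
    intro q
    simp only [split, List.mem_flatMap]
    constructor
    · rintro ⟨p, hp, hq⟩
      split_ifs at hq with hpw
      · simp only [List.mem_cons, List.not_mem_nil, or_false] at hq
        rcases hq with hq | hq
        · exact .inr ⟨p, hp, hpw, false, hq⟩
        · exact .inr ⟨p, hp, hpw, true, hq⟩
      · rw [List.mem_singleton] at hq
        subst hq
        exact .inl ⟨hp, hpw⟩
    · rintro (⟨hq, hqw⟩ | ⟨p, hp, hpw, b, rfl⟩)
      · exact ⟨q, hq, by simp [hqw]⟩
      · exact ⟨p, hp, by cases b <;> simp [hpw]⟩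
  refine ⟨h.loose, .replicate _ _ h.tight hw, ?_, ?_, fun z => ?_, ?_, ?_, ?_⟩
  · have hext : ∀ p q : List Bool × List Bool, q ∈ (if p.1 = w then
        [(p.1 ++ [false], p.2 ++ [false]), (p.1 ++ [true], p.2 ++ [true])] else [p]) →
        p.1 <+: q.1 ∧ p.2 <+: q.2 := by
      intro p q hq
      split_ifs at hq
      · simp only [List.mem_cons, List.not_mem_nil, or_false] at hq
        rcases hq with rfl | rfl <;> exact ⟨List.prefix_append _ _, List.prefix_append _ _⟩
      · rw [List.mem_singleton.1 hq]
        exact ⟨List.prefix_rfl, List.prefix_rfl⟩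
    refine List.pairwise_flatMap.2 ⟨fun p _ => ?_, List.Pairwise.imp ?_ h.antichain⟩
    · split_ifs
      · exact List.pairwise_pair.2 ⟨incomp_concat _, incomp_concat _⟩
      · exact List.pairwise_singleton _ _
    · rintro p q ⟨h1, h2⟩ p' hp' q' hq'
      exact ⟨h1.mono (hext p p' hp').1 (hext q q' hq').1,
        h2.mono (hext p p' hp').2 (hext q q' hq').2⟩
  · intro q hq
    rcases (hmem q).1 hq with ⟨hq, hqw⟩ | ⟨p, hp, hpw, b, rfl⟩
    · have ho := h.outer q hq
      refine ⟨ho.1.append _, fun u hu hqu => ?_⟩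
      rcases isActual_concat_replicate.1 hu with hu | ⟨b, rfl⟩
      · exact ho.2 u hu hqu
      · rcases List.prefix_concat_iff.1 hqu with h1 | h1
        · exact h1.symm
        · exact absurd (ho.2 w hw.1 h1).symm hqw
    · simp only
      rw [hpw]
      refine ⟨isActual_concat_replicate.2 (.inr ⟨b, rfl⟩), fun u hu hqu => ?_⟩
      rcases isActual_concat_replicate.1 hu with hu | ⟨b', rfl⟩
      · have h1 := hw.2 u hu ((List.prefix_append _ _).trans hqu)
        rw [h1] at hqu
        have := hqu.length_le
        simp at this
      · exact (hqu.eq_of_length (by simp)).symm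
  · obtain ⟨p, hp, hz⟩ := h.cover z
    by_cases hpw : p.1 = w
    · refine ⟨_, (hmem _).2 (.inr ⟨p, hp, hpw, (z.drop p.1.length).head, rfl⟩), ?_⟩
      have : z = (p.1 ++ [(z.drop p.1.length).head]) ++ₛ (z.drop p.1.length).tail := by
        rw [Stream'.append_append_stream, Stream'.append_stream_head_tail]
        exact hz.eq_append
      conv_rhs => rw [this]
      exact onStream_append _ _
    · exact ⟨p, (hmem _).2 (.inl ⟨hp, hpw⟩), hz⟩
  · intro q hq z z'
    rw [thread_append, thread_replicate, List.append_nil]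
    rcases (hmem q).1 hq with ⟨hq, -⟩ | ⟨p, hp, -, b, rfl⟩
    · exact h.thread_eq q hq z z'
    · simp only
      rw [Stream'.append_append_stream, Stream'.append_append_stream]
      exact h.thread_eq p hp _ _
  · rw [switches_append, switches_replicate, List.append_nil, h.length_switches]
  · rw [lastSwitch_append_of_nil (switches_replicate _ _)]
    obtain ⟨p, hp, h1, h2⟩ := h.last
    by_cases hpw : p.1 = w
    -- If the selected pair is split, its 0-child has the same extension by zeros.
    · exact ⟨_, (hmem _).2 (.inr ⟨p, hp, hpw, false, rfl⟩), by rw [zeroExt_concat, h1],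
        by rw [zeroExt_concat, h2]⟩
    · exact ⟨p, (hmem _).2 (.inl ⟨hp, hpw⟩), h1, h2⟩

theorem step_antecedent (h : LooseTightInv A L X Y) {m : Move}
    (hm : X ++ [(.top, m)] ∈ A.looseRec.legalPos) :
    LooseTightInv A (looseReact L m).1 (X ++ [(.top, m)])
      (Y ++ (looseReact L m).2.map (Prod.mk .top)) := by
  obtain ⟨x, α, rfl⟩ : ∃ x α, m = inNode x α := by
    rcases (looseRec_mem_legalPos.1 hm).1 (.top, m) (by simp) with ⟨w, hw⟩ | ⟨p, w, α, hw⟩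
    · cases (Prod.mk.inj hw).1
    · exact ⟨w, α, (Prod.mk.inj hw).2⟩
  have := (h.pad (inNode x α)).append_movesAt_tight (x := x) (α := α) (fun p hp => ?_) hm
  · simpa [looseReact, parse_inNode, movesAt, Function.comp_def] using this
  -- The padding has the length of the whole move, which exceeds that of its address x.
  · have h1 := length_le_of_mem_pad hp
    simp only [inNode, switch, List.length_append, List.length_map] at h1
    omega

theorem step_consequent (h : LooseTightInv A L X Y) {m : Move}
    (hm : TightLegal A (Y ++ [(.bot, m)])) :
    LooseTightInv A (tightReact L m).1 (X ++ (tightReact L m).2.map (Prod.mk .bot))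
      (Y ++ [(.bot, m)]) := by
  obtain ⟨-, ⟨-, w, rfl, hw⟩ | ⟨-, w, rfl, hw⟩ | ⟨w, α, rfl, hw, -⟩⟩ := hm.concat_cases
  · have := (h.pad (switch w)).append_switch hw
    rw [tightReact, parse_switch]
    exact this
  · have := (h.pad (replicate w)).append_replicate hw
    rw [tightReact, parse_replicate]
    simpa using this
  · have := (h.pad (inNode w α)).append_movesAt_loose hw hm
    rw [tightReact, parse_inNode]
    simpa [movesAt, Function.comp_def] using this

end LooseTightInv

theorem uniformlyValid_loose_imp_tight :
    UniformlyValid fun P => (Game.looseRec P).imp (Game.tightRec P) := by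
  refine ⟨_, fun A _ => imp_wins (s₀ := [([], [])]) primrec_looseReact primrec_tightReact
    (LooseTightInv A) (.nil A) (fun _ _ _ h => ⟨h.loose, h.tight⟩)
    (fun _ _ _ _ h hm => h.step_antecedent hm) (fun _ _ _ _ h hm => h.step_consequent hm) ?_⟩
  intro X Y Γ Δ cX cY hX hY hI hb
  rw [tightRec_winner (hY.legal cY fun t => (hI t).choose_spec.tight)] at hb
  rw [looseRec_winner (hX.legal cX fun t => (hI t).choose_spec.loose)]
  exact recOutcome_eq_bot_of A hX hY cX cY (fun t => (hI t).choose_spec.length_switches)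
    (fun t => (hI t).choose_spec.thread_lastSwitch) hb

end CoL

theorem theorem6p1 :
    CoL.UniformlyValid (fun P => (CoL.Game.tightRec P).imp (CoL.Game.looseRec P)) ∧
    CoL.UniformlyValid (fun P => (CoL.Game.looseRec P).imp (CoL.Game.tightRec P)) :=
  ⟨CoL.uniformlyValid_tight_imp_loose, CoL.uniformlyValid_loose_imp_tight⟩
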